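/- Let $1\le m\le n$ be integers, let $M_1,\dots,M_m\ge 1$ be integers and let $\alpha\in\mathbb R$. Let $\mathbb B_n$ be the open Euclidean unit ball of $\mathbb C^n$. The Dirichlet-type space $D_\alpha(\mathbb B_n)$ consists of the holomorphic functions $f(z)=\sum_k a_kz^k$ on $\mathbb B_n$ with $$\|f\|_\alpha^2=\sum_{k\in\mathbb Z_{\ge0}^n}(n+|k|)^\alpha\frac{(n-1)!\,k!}{(n-1+|k|)!}|a_k|^2<\infty .$$ A function $f\in D_\alpha(\mathbb B_n)$ is cyclic if the closure in $D_\alpha(\mathbb B_n)$ of the linear span of $\{z^kf:k\in\mathbb Z_{\ge0}^n\}$ is all of $D_\alpha(\mathbb B_n)$. For an integer $N\ge 0$ let $P_N^n$ be the space of complex polynomials in $z_1,\dots,z_n$ of degree at most $N$ in each variable, and let $$\mathrm{dist}_{D_\alpha(\mathbb B_n)}(1,f\cdot P_N^n)=\inf\{\|pf-1\|_\alpha:p\in P_N^n\}.$$ Put $$\mu=\frac{(M_1+\dots+M_m)^{M_1+\dots+M_m}}{M_1^{M_1}\cdots M_m^{M_m}},\qquad \beta=\alpha-n+\frac{m+1}{2},\qquad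 \mathbb D_\mu=\{w\in\mathbb C:|w|<\mu^{-1/4}\},$$ and let $d_\beta$ be the space of holomorphic functions $\tilde f(w)=\sum_{l\ge0}a_lw^l$ on $\mathbb D_\mu$ with $\sum_{l\ge 0}\mu^{-l/2}(l+1)^\beta|a_l|^2<\infty$. For $t>0$ let $\phi_\beta(t)=t^{1-\beta}$ if $\beta<1$ and $\phi_1(t)=\max\{\log t,0\}$. **Theorem.** Assume $\beta\le1$ (equivalently $\alpha\le\frac{2n-m+1}{2}$). Let $f\in D_\alpha(\mathbb B_n)$ be of the form $$f(z)=\tilde f\bigl(\mu^{1/4}z_1^{M_1}\cdots z_m^{M_m}\bigr),\qquad z\in\mathbb B_n,$$ with $\tilde f\in d_\beta$. Suppose that $\tilde f$ has no zeros in $\mathbb D_\mu$, that $\tilde f$ extends analytically to an open neighbourhood of the closed disk $\overline{\mathbb D_\mu}$, and that the extension has at least one zero on the circle $|w|=\mu^{-1/4}$. Then $f$ is cyclic in $D_\alpha(\mathbb B_n)$, and there are constants $c,C>0$, independent of $N$, such that $$c\,\phi_\beta(N+1)^{-1}\le \mathrm{dist}^2_{D_\alpha(\mathbb B_n)}(1,f\cdot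 P_N^n)\le C\,\phi_\beta(N+1)^{-1}$$ for all integers $N\ge0$ if $\beta<1$, and for all integers $N\ge1$ if $\beta=1$. -/

import Mathlib

open scoped ENNReal

namespace DirichletBall

noncomputable section

/-- Complex Euclidean `n`-space with its Hermitian norm. -/
abbrev Cn (n : ℕ) : Type := EuclideanSpace ℂ (Fin n)

/-- The open unit ball of `ℂⁿ`. -/
def unitBall (n : ℕ) : Set (Cn n) := Metric.ball 0 1

/-- The monomial `z^k = z_1^{k_1} ⋯ z_n^{k_n}`. -/
def monom {n : ℕ} (k : Fin n → ℕ) (z : Cn n) : ℂ := ∏ i, z i ^ k i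

/-- `f(z) = ∑_k a_k z^k` on the unit ball (unconditional, i.e. absolute, convergence). -/
def HasExpansion {n : ℕ} (f : Cn n → ℂ) (a : (Fin n → ℕ) → ℂ) : Prop :=
  ∀ z ∈ unitBall n, HasSum (fun k => a k * monom k z) (f z)

/-- The weight `(n+|k|)^α (n-1)! k! / (n-1+|k|)!` (used for `n ≥ 1`). -/
def weight (n : ℕ) (α : ℝ) (k : Fin n → ℕ) : ℝ :=
  ((n : ℝ) + ((∑ i, k i : ℕ) : ℝ)) ^ α *
    (((n - 1).factorial : ℝ) * ∏ i, ((k i).factorial : ℝ)) / ((n - 1 + ∑ i, k i).factorial : ℝ)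

/-- `‖f‖_α² = ∑_k (n+|k|)^α (n-1)! k!/(n-1+|k|)! |a_k|²`, where `f = ∑ a_k z^k` in the ball.
There is at most one expansion of `f`, so the infimum is over at most one sequence, see
`HasExpansion.unique` and `normSq_eq`; a function without an expansion has norm `∞`. -/
def normSq {n : ℕ} (α : ℝ) (f : Cn n → ℂ) : ℝ≥0∞ :=
  ⨅ (a : (Fin n → ℕ) → ℂ) (_ : HasExpansion f a),
    ∑' k, ENNReal.ofReal (weight n α k * ‖a k‖ ^ 2)

/-- The norm `‖f‖_α`. -/
def dirichletNorm {n : ℕ} (α : ℝ) (f : Cn n → ℂ) : ℝ≥0∞ := normSq α f ^ (1 / 2 : ℝ)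

/-- The Dirichlet-type space `D_α(𝔹_n)`: holomorphic functions on the ball of finite norm.
Its elements are functions on `ℂⁿ` whose values off the ball play no role. -/
def dirichletSpace (n : ℕ) (α : ℝ) : Set (Cn n → ℂ) :=
  {f | DifferentiableOn ℂ f (unitBall n) ∧ dirichletNorm α f < ∞}

/-- `[f]`: the closure in `D_α(𝔹_n)` of the linear span of the functions `z^k f`. -/
def closedInvariantSubspace {n : ℕ} (α : ℝ) (f : Cn n → ℂ) : Set (Cn n → ℂ) :=
  {g ∈ dirichletSpace n α | ∀ ε : ℝ≥0∞, 0 < ε →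
    ∃ h ∈ Submodule.span ℂ (Set.range fun k : Fin n → ℕ => fun z : Cn n => monom k z * f z),
      dirichletNorm α (g - h) < ε}

/-- `f` is a cyclic vector of `D_α(𝔹_n)`. -/
def IsCyclic {n : ℕ} (α : ℝ) (f : Cn n → ℂ) : Prop :=
  f ∈ dirichletSpace n α ∧ closedInvariantSubspace α f = dirichletSpace n α

/-- `dist_{D_α}(1, f · P_N^n)`, where `P_N^n` consists of the polynomials in `n` variables of
degree at most `N` in each variable. -/
def distOne {n : ℕ} (α : ℝ) (f : Cn n → ℂ) (N : ℕ) : ℝ≥0∞ :=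
  ⨅ p ∈ MvPolynomial.restrictDegree (Fin n) ℂ N,
    dirichletNorm α (fun z : Cn n => 1 - MvPolynomial.eval (fun i => z i) p * f z)

/-- The first `m` of the `n` indices. -/
def firstIdx (n m : ℕ) : Finset (Fin n) := Finset.univ.filter fun i => (i : ℕ) < m

/-- `μ(m) = (M_1+⋯+M_m)^{M_1+⋯+M_m} / (M_1^{M_1} ⋯ M_m^{M_m})`. -/
def mu {n : ℕ} (M : Fin n → ℕ) (m : ℕ) : ℝ :=
  (((∑ i ∈ firstIdx n m, M i : ℕ) : ℝ) ^ (∑ i ∈ firstIdx n m, M i)) /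
    ∏ i ∈ firstIdx n m, ((M i : ℝ) ^ M i)

/-- The radius `μ(m)^{-1/4}` of the disk on which the one-variable function lives. -/
def radius {n : ℕ} (M : Fin n → ℕ) (m : ℕ) : ℝ := mu M m ^ (-(1 / 4) : ℝ)

/-- The space `d_β` of holomorphic functions `∑ a_l w^l` on the disk `|w| < μ(m)^{-1/4}` with
`∑ μ(m)^{-l/2} (l+1)^β |a_l|² < ∞`. -/
def diskSpace {n : ℕ} (M : Fin n → ℕ) (m : ℕ) (β : ℝ) : Set (ℂ → ℂ) :=
  {g | DifferentiableOn ℂ g (Metric.ball 0 (radius M m)) ∧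
    Summable fun l : ℕ => mu M m ^ (-(l : ℝ) / 2) * ((l : ℝ) + 1) ^ β *
      ‖iteratedDeriv l g 0 / (l.factorial : ℂ)‖ ^ 2}

/-- `β(α) = α - n + (m+1)/2`. -/
def betaOf (n m : ℕ) (α : ℝ) : ℝ := α - n + ((m : ℝ) + 1) / 2

/-- `f ∈ D_α(𝔹_n)` belongs to the diagonal subspace `J_{α,M,m}`, with corresponding one-variable
function `g ∈ d_{β(α)}`: `f(z) = g(μ(m)^{1/4} z_1^{M_1} ⋯ z_m^{M_m})` on the ball. -/
def IsDiagonal {n : ℕ} (α : ℝ) (M : Fin n → ℕ) (m : ℕ) (f : Cn n → ℂ) (g : ℂ → ℂ) : Prop :=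
  f ∈ dirichletSpace n α ∧ g ∈ diskSpace M m (betaOf n m α) ∧
    ∀ z ∈ unitBall n, f z = g (((mu M m ^ (1 / 4 : ℝ) : ℝ) : ℂ) * ∏ i ∈ firstIdx n m, z i ^ M i)

/-- `φ_β(t) = t^{1-β}` for `β < 1` and `φ_1(t) = log⁺ t`. -/
def phi (β t : ℝ) : ℝ := if β < 1 then t ^ (1 - β) else max (Real.log t) 0

/-- A function on the ball has at most one expansion: its values on a small torus determine the
coefficients. -/
theorem HasExpansion.unique {n : ℕ} {f : Cn n → ℂ} {a b : (Fin n → ℕ) → ℂ}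
    (ha : HasExpansion f a) (hb : HasExpansion f b) : a = b := by
  let _ : MeasureTheory.MeasureSpace UnitAddCircle := ⟨AddCircle.haarAddCircle⟩
  have _ : MeasureTheory.IsProbabilityMeasure
      (MeasureTheory.volume : MeasureTheory.Measure UnitAddCircle) :=
    inferInstanceAs (MeasureTheory.IsProbabilityMeasure AddCircle.haarAddCircle)
  set r : ℝ := 1 / ((n : ℝ) + 1) with hr
  have hr0 : 0 < r := by positivity
  have hmem : ∀ w : Fin n → ℂ, (∀ i, ‖w i‖ = r) → (WithLp.toLp 2 w : Cn n) ∈ unitBall n := by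
    intro w hw
    rw [unitBall, mem_ball_zero_iff, EuclideanSpace.norm_eq, Real.sqrt_lt' one_pos]
    simp only [hw, Finset.sum_const, Finset.card_univ, Fintype.card_fin, nsmul_eq_mul, hr]
    rw [div_pow, one_pow, mul_one_div, div_lt_one (by positivity)]
    nlinarith [(Nat.cast_nonneg n : (0 : ℝ) ≤ n)]
  set c : (Fin n → ℕ) → ℂ := fun k => (a k - b k) * ∏ i, (r : ℂ) ^ k i with hc
  have key : ∀ x : UnitAddTorus (Fin n),
      HasSum (fun k => c k * UnitAddTorus.mFourier (fun i => (k i : ℤ)) x) 0 := by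
    intro x
    have hw := hmem (fun i => (r : ℂ) * fourier 1 (x i)) (fun i => by
      simp [abs_of_pos hr0, Circle.norm_coe])
    have h := (ha _ hw).sub (hb _ hw)
    rw [sub_self] at h
    have e : (fun k => c k * UnitAddTorus.mFourier (fun i => (k i : ℤ)) x) = fun k =>
        a k * monom k (WithLp.toLp 2 fun i => (r : ℂ) * fourier 1 (x i)) -
          b k * monom k (WithLp.toLp 2 fun i => (r : ℂ) * fourier 1 (x i)) := by
      funext k
      simp only [hc, monom, UnitAddTorus.mFourier, ContinuousMap.coe_mk, mul_pow,
        Finset.prod_mul_distrib]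
      have : ∀ i, (fourier 1 (x i) : ℂ) ^ k i = fourier (k i : ℤ) (x i) := by
        intro i
        simp [fourier_apply, AddCircle.toCircle_nsmul]
      simp only [this]
      ring
    rw [e]
    exact h
  have hs : Summable c := by
    have h := (key 0)
    simpa [UnitAddTorus.mFourier] using h.summable
  have hC : HasSum (fun k => c k • UnitAddTorus.mFourier (d := Fin n) (fun i => (k i : ℤ))) 0 := by
    have : Summable (fun k => c k • UnitAddTorus.mFourier (d := Fin n) (fun i => (k i : ℤ))) := by
      refine Summable.of_norm ?_
      simpa [norm_smul, UnitAddTorus.mFourier_norm] using hs.norm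
    convert this.hasSum
    symm
    ext x
    rw [← ContinuousMap.tsum_apply this]
    simpa using (key x).tsum_eq
  have hL := hC.mapL (ContinuousMap.toLp (E := ℂ) 2 MeasureTheory.volume ℂ)
  funext j
  have hi := hL.mapL (innerSL ℂ (UnitAddTorus.mFourierLp 2 (fun i => (j i : ℤ))))
  have ho := orthonormal_iff_ite.1 (UnitAddTorus.orthonormal_mFourier (d := Fin n))
  have hinj : ∀ k : Fin n → ℕ, k ≠ j → ¬ (fun i => (j i : ℤ)) = (fun i => (k i : ℤ)) := by
    intro k hk h
    exact hk (funext fun i => by exact_mod_cast (congrFun h i).symm)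
  have hz : ∀ k, innerSL ℂ (UnitAddTorus.mFourierLp 2 (fun i => (j i : ℤ)))
      (ContinuousMap.toLp (E := ℂ) 2 MeasureTheory.volume ℂ
        (c k • UnitAddTorus.mFourier (d := Fin n) (fun i => (k i : ℤ)))) =
      if k = j then c j else 0 := by
    intro k
    rw [map_smul, map_smul, innerSL_apply_apply]
    have := ho (fun i => (j i : ℤ)) (fun i => (k i : ℤ))
    rw [UnitAddTorus.mFourierLp] at this
    erw [this]
    by_cases hk : k = j
    · subst hk; simp
    · simp [hk, hinj k hk]
  simp only [hz, map_zero] at hi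
  have h0 : c j = 0 := by
    have h1 := hasSum_ite_eq j (c j)
    exact h1.unique hi
  have hp : (∏ i, (r : ℂ) ^ j i) ≠ 0 :=
    Finset.prod_ne_zero_iff.2 fun i _ => pow_ne_zero _ (by exact_mod_cast hr0.ne')
  exact sub_eq_zero.1 ((mul_eq_zero.1 h0).resolve_right hp)

/-- The norm is computed by the coefficients of any expansion. -/
theorem normSq_eq {n : ℕ} (α : ℝ) {f : Cn n → ℂ} {a : (Fin n → ℕ) → ℂ} (ha : HasExpansion f a) :
    normSq α f = ∑' k, ENNReal.ofReal (weight n α k * ‖a k‖ ^ 2) := by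
  refine le_antisymm (iInf₂_le a ha) (le_iInf₂ fun b hb => ?_)
  rw [hb.unique ha]

end

end DirichletBall

/-! Write `h w = G (r * w)` with `r` the radius, so that `f` is `h` composed with `μ^{1/2} z_1^{M_1}
⋯ z_m^{M_m}`. By Stirling, the weight at the exponent of the `l`-th power of this monomial, times
`μ^l`, is of order `(l+1)^β` (`isTheta_weight_diagExp`). The ball norm of a function of the monomial
is therefore comparable with the one-variable norm `wNormSq β`. For a general polynomial `p`, the
diagonal coefficients of `1 - p f` involve only the diagonal coefficients of `p`, and discarding the
other coefficients only lowers the norm. The problem becomes one-variable.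

On the closed unit disk `h = P g`, where `P` is a product of factors `X - ζ` with `|ζ| = 1`, and `g`
and `1/g` are analytic past the circle, with coefficient series `u` and `v`.

Upper bound (`exists_wNormSq_one_sub_mul_le`): the truncated reproducing kernel at `ζ`, normalised
to be `1` at `ζ`, has coefficient sum `1` and squared norm `1 / kernelSum`. One minus it is a
multiple of `X - ζ`, so `X - ζ` has a polynomial approximate inverse with this error. Truncations of
`v` do the same for `u`. Errors of this size (`IsSmall`) form a class closed under sums and
products, so the approximate inverses can be multiplied together.

Lower bound (`exists_le_wNormSq_one_sub_mul`): if `y = 1 - q P u`, then `v y = v - q P`. Long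
partial sums of this series at a zero `ζ` of `P` equal those of `v` and stay away from `0`.
Cauchy–Schwarz bounds them by the norm of `y` times the square root of `kernelSum`.

Finally `kernelSum` is comparable with `phi`. For `β ≤ 1` it tends to infinity, so `1` is
approximated by multiples of `f`; density of polynomials then gives cyclicity. -/

namespace DirichletBall

/-! ### Convolution inequalities for weighted norms of power series. -/

open PowerSeries Finset

/-- The sum of the moduli of the coefficients of a power series. -/
noncomputable def coeffSum (a : ℂ⟦X⟧) : ℝ≥0∞ := ∑' l, ‖coeff l a‖ₑ

/-- The squared weighted norm `∑ (l+1)^β |a_l|²` of a power series. -/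
noncomputable def wNormSq (β : ℝ) (a : ℂ⟦X⟧) : ℝ≥0∞ :=
  ∑' l : ℕ, ENNReal.ofReal (((l : ℝ) + 1) ^ β) * ‖coeff l a‖ₑ ^ 2

theorem tsum_mul_tsum_antidiagonal (x y : ℕ → ℝ≥0∞) :
    ∑' l, ∑ ij ∈ antidiagonal l, x ij.1 * y ij.2 = (∑' i, x i) * ∑' j, y j := by
  calc ∑' l, ∑ ij ∈ antidiagonal l, x ij.1 * y ij.2
      = ∑' l, ∑' ij : antidiagonal l, x ij.1.1 * y ij.1.2 := by
        refine tsum_congr fun l => ?_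
        exact (Finset.tsum_subtype (antidiagonal l) (fun ij : ℕ × ℕ => x ij.1 * y ij.2)).symm
    _ = ∑' p : ℕ × ℕ, x p.1 * y p.2 := by
        rw [← ENNReal.tsum_sigma (fun l (ij : antidiagonal l) => x ij.1.1 * y ij.1.2)]
        exact HasAntidiagonal.sigmaAntidiagonalEquivProd.tsum_eq
          (fun p : ℕ × ℕ => x p.1 * y p.2)
    _ = (∑' i, x i) * ∑' j, y j := by
        rw [ENNReal.tsum_prod (f := fun i j => x i * y j)]
        simp_rw [ENNReal.tsum_mul_left, ENNReal.tsum_mul_right]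

theorem sum_antidiagonal_fst_le_tsum (x : ℕ → ℝ≥0∞) (l : ℕ) :
    ∑ ij ∈ antidiagonal l, x ij.1 ≤ ∑' i, x i := by
  rw [Finset.Nat.sum_antidiagonal_eq_sum_range_succ (fun i _ => x i)]
  exact ENNReal.sum_le_tsum _

theorem sq_sum_mul_le {ι : Type*} (s : Finset ι) (w f : ι → ℝ≥0∞) :
    (∑ i ∈ s, w i * f i) ^ 2 ≤ (∑ i ∈ s, w i) * ∑ i ∈ s, w i * f i ^ 2 := by
  have h := ENNReal.inner_le_weight_mul_Lp_of_nonneg s (p := 2) (by norm_num) w f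
  have h2 := pow_le_pow_left₀ (zero_le) h 2
  refine h2.trans (le_of_eq ?_)
  rw [mul_pow, ← ENNReal.rpow_natCast, ← ENNReal.rpow_natCast, ← ENNReal.rpow_mul,
    ← ENNReal.rpow_mul]
  norm_num

/-- Young's inequality `ℓ¹ * ℓ² ⊆ ℓ²`: Cauchy–Schwarz with weight `x` on each antidiagonal, then
summation over `l`. -/
theorem tsum_sq_conv_le (x y : ℕ → ℝ≥0∞) :
    ∑' l, (∑ ij ∈ antidiagonal l, x ij.1 * y ij.2) ^ 2 ≤ (∑' i, x i) ^ 2 * ∑' j, y j ^ 2 := by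
  calc ∑' l, (∑ ij ∈ antidiagonal l, x ij.1 * y ij.2) ^ 2
      ≤ ∑' l, (∑' i, x i) * ∑ ij ∈ antidiagonal l, x ij.1 * y ij.2 ^ 2 := by
        refine ENNReal.tsum_le_tsum fun l => (sq_sum_mul_le _ _ _).trans ?_
        gcongr
        exact sum_antidiagonal_fst_le_tsum x l
    _ = (∑' i, x i) ^ 2 * ∑' j, y j ^ 2 := by
        rw [ENNReal.tsum_mul_left, tsum_mul_tsum_antidiagonal x (fun j => y j ^ 2), sq, mul_assoc]

theorem add_sq_le_two_mul (x y : ℝ≥0∞) : (x + y) ^ 2 ≤ 2 * (x ^ 2 + y ^ 2) := by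
  have h := ENNReal.rpow_add_le_mul_rpow_add_rpow x y (p := 2) (by norm_num)
  norm_num at h
  simpa using h

theorem enorm_coeff_mul_le (a b : ℂ⟦X⟧) (l : ℕ) :
    ‖coeff l (a * b)‖ₑ ≤ ∑ ij ∈ antidiagonal l, ‖coeff ij.1 a‖ₑ * ‖coeff ij.2 b‖ₑ := by
  rw [coeff_mul]
  refine (enorm_sum_le _ _).trans (le_of_eq (sum_congr rfl fun _ _ => enorm_mul _ _))

theorem coeffSum_add_le (a b : ℂ⟦X⟧) : coeffSum (a + b) ≤ coeffSum a + coeffSum b := by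
  rw [coeffSum, coeffSum, coeffSum, ← ENNReal.tsum_add]
  exact ENNReal.tsum_le_tsum fun l => by simpa using enorm_add_le _ _

theorem coeffSum_mul_le (a b : ℂ⟦X⟧) : coeffSum (a * b) ≤ coeffSum a * coeffSum b := by
  rw [coeffSum, coeffSum, coeffSum, ← tsum_mul_tsum_antidiagonal]
  exact ENNReal.tsum_le_tsum fun l => enorm_coeff_mul_le a b l

theorem coeffSum_neg (a : ℂ⟦X⟧) : coeffSum (-a) = coeffSum a := by simp [coeffSum]

theorem wNormSq_neg (β : ℝ) (a : ℂ⟦X⟧) : wNormSq β (-a) = wNormSq β a := by simp [wNormSq]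

theorem wNormSq_add_le (β : ℝ) (a b : ℂ⟦X⟧) :
    wNormSq β (a + b) ≤ 2 * (wNormSq β a + wNormSq β b) := by
  rw [wNormSq, wNormSq, wNormSq, ← ENNReal.tsum_add, ← ENNReal.tsum_mul_left]
  refine ENNReal.tsum_le_tsum fun l => ?_
  rw [map_add, ← mul_add, mul_left_comm]
  gcongr
  exact (pow_le_pow_left₀ zero_le (enorm_add_le _ _) 2).trans (add_sq_le_two_mul _ _)

/-- Subadditivity of concave powers when `0 ≤ s`; for negative `s` the first summand alone suffices,
by monotonicity. -/
theorem rpow_succ_add_le {s : ℝ} (hs : s ≤ 1) (i j : ℕ) :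
    (((i + j : ℕ) : ℝ) + 1) ^ s ≤ ((i : ℝ) + 1) ^ s + ((j : ℝ) + 1) ^ s := by
  have hi : (0 : ℝ) ≤ (i : ℝ) := Nat.cast_nonneg i
  have hj : (0 : ℝ) ≤ (j : ℝ) := Nat.cast_nonneg j
  push_cast
  rcases le_total 0 s with h | h
  · refine (Real.rpow_le_rpow (by positivity) ?_ h).trans
      (Real.rpow_add_le_add_rpow (a := (i : ℝ) + 1) (b := (j : ℝ) + 1) (by positivity)
        (by positivity) h hs)
    linarith
  · have h1 : ((i : ℝ) + j + 1) ^ s ≤ ((i : ℝ) + 1) ^ s :=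
      Real.rpow_le_rpow_of_nonpos (by positivity) (by linarith) h
    have h2 : (0 : ℝ) ≤ ((j : ℝ) + 1) ^ s := by positivity
    linarith

/-- For `β ≤ 2` the square root `(l+1)^{β/2}` of the weight is subadditive, so in each product `a_i
b_j` the weight can be placed on one factor or the other; Young's inequality handles both sums. -/
theorem wNormSq_mul_le {β : ℝ} (hβ : β ≤ 2) (a b : ℂ⟦X⟧) :
    wNormSq β (a * b) ≤
      2 * (coeffSum a ^ 2 * wNormSq β b + coeffSum b ^ 2 * wNormSq β a) := by
  set ω : ℕ → ℝ≥0∞ := fun l => ENNReal.ofReal (((l : ℝ) + 1) ^ (β / 2)) with hω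
  have hsq : ∀ l : ℕ, ENNReal.ofReal (((l : ℝ) + 1) ^ β) = ω l ^ 2 := by
    intro l
    rw [hω, ← ENNReal.ofReal_pow (by positivity), ← Real.rpow_natCast,
      ← Real.rpow_mul (by positivity)]
    norm_num
  have hadd : ∀ i j : ℕ, ω (i + j) ≤ ω i + ω j := by
    intro i j
    rw [hω, ← ENNReal.ofReal_add (by positivity) (by positivity)]
    exact ENNReal.ofReal_le_ofReal (rpow_succ_add_le (by linarith) i j)
  have hS : ∀ c : ℂ⟦X⟧, wNormSq β c = ∑' l, (ω l * ‖coeff l c‖ₑ) ^ 2 := fun c =>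
    tsum_congr fun l => by rw [hsq, mul_pow]
  calc wNormSq β (a * b)
      ≤ ∑' l, 2 * ((∑ ij ∈ antidiagonal l, ‖coeff ij.1 a‖ₑ * (ω ij.2 * ‖coeff ij.2 b‖ₑ)) ^ 2 +
          (∑ ij ∈ antidiagonal l, ‖coeff ij.1 b‖ₑ * (ω ij.2 * ‖coeff ij.2 a‖ₑ)) ^ 2) := by
        rw [hS]
        refine ENNReal.tsum_le_tsum fun l => ?_
        refine (pow_le_pow_left₀ zero_le ?_ 2).trans (add_sq_le_two_mul _ _)
        -- Reflecting the antidiagonal puts the weighted factor second in both sums, the shape of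
        -- `tsum_sq_conv_le`.
        rw [← Finset.Nat.sum_antidiagonal_swap
          (f := fun ij : ℕ × ℕ => ‖coeff ij.1 b‖ₑ * (ω ij.2 * ‖coeff ij.2 a‖ₑ)),
          ← sum_add_distrib]
        refine (mul_le_mul_right (enorm_coeff_mul_le a b l) (ω l)).trans ?_
        rw [mul_sum]
        refine sum_le_sum fun ij hij => ?_
        rw [← mem_antidiagonal.1 hij]
        refine (mul_le_mul_left (hadd _ _) _).trans (le_of_eq ?_)
        simp only [Prod.fst_swap, Prod.snd_swap]
        ring
    _ ≤ _ := by
        rw [ENNReal.tsum_mul_left, ENNReal.tsum_add, hS a, hS b]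
        gcongr
        · exact tsum_sq_conv_le (fun i => ‖coeff i a‖ₑ) (fun j => ω j * ‖coeff j b‖ₑ)
        · exact tsum_sq_conv_le (fun i => ‖coeff i b‖ₑ) (fun j => ω j * ‖coeff j a‖ₑ)

end DirichletBall

/-! ### One-variable upper bound: approximate inverses of the factors. -/

namespace DirichletBall

open PowerSeries Finset

/-- The partial sums `∑_{i<n} (i+1)^{-β}`. -/
noncomputable def kernelSum (β : ℝ) (n : ℕ) : ℝ := ∑ i ∈ range n, ((i : ℝ) + 1) ^ (-β)

theorem kernelSum_pos (β : ℝ) {n : ℕ} (hn : 0 < n) : 0 < kernelSum β n :=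
  sum_pos (fun i _ => by positivity) ⟨0, by simpa using hn⟩

theorem kernelSum_mono (β : ℝ) : Monotone (kernelSum β) := fun _ _ h =>
  sum_le_sum_of_subset_of_nonneg (range_mono h) fun i _ _ => by positivity

/-- Doubling property: it makes a bounded multiple of the degree cost only a constant factor. -/
theorem kernelSum_mul_le (β : ℝ) {J : ℕ} (hJ : 0 < J) :
    ∃ C : ℝ, 0 < C ∧ ∀ n, kernelSum β (J * n) ≤ C * kernelSum β n := by
  have hJ' : (1 : ℝ) ≤ J := by exact_mod_cast hJ
  -- The `n`-th block has `J` terms, each at most `J^{-β}` (if `β ≤ 0`) or `1` (if `β ≥ 0`) times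
  -- `(n+1)^{-β}`; the sum covers both signs.
  refine ⟨J * (1 + (J : ℝ) ^ (-β)), by positivity, fun n => ?_⟩
  induction n with
  | zero => simp [kernelSum]
  | succ n ih =>
    rw [Nat.mul_succ, kernelSum, sum_range_add, kernelSum, sum_range_succ, mul_add]
    refine add_le_add ih ?_
    have hterm : ∀ r ∈ range J, (((J * n + r : ℕ) : ℝ) + 1) ^ (-β) ≤
        (1 + (J : ℝ) ^ (-β)) * ((n : ℝ) + 1) ^ (-β) := by
      intro r hr
      have hr' : (r : ℝ) + 1 ≤ J := by exact_mod_cast mem_range.1 hr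
      have hn0 : (0 : ℝ) ≤ n := Nat.cast_nonneg n
      have hr0 : (0 : ℝ) ≤ r := Nat.cast_nonneg r
      have hp1 : (0 : ℝ) ≤ (J : ℝ) ^ (-β) * ((n : ℝ) + 1) ^ (-β) := by positivity
      have hp2 : (0 : ℝ) ≤ ((n : ℝ) + 1) ^ (-β) := by positivity
      push_cast
      rcases le_total 0 (-β) with h | h
      · have h1 : ((J : ℝ) * n + r + 1) ^ (-β) ≤ ((J : ℝ) * ((n : ℝ) + 1)) ^ (-β) :=
          Real.rpow_le_rpow (by positivity) (by nlinarith) h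
        rw [Real.mul_rpow (by positivity) (by positivity)] at h1
        linarith
      · have h1 : ((J : ℝ) * n + r + 1) ^ (-β) ≤ ((n : ℝ) + 1) ^ (-β) :=
          Real.rpow_le_rpow_of_nonpos (by positivity) (by nlinarith) h
        linarith
    refine (sum_le_sum hterm).trans (le_of_eq ?_)
    simp only [sum_const, card_range, nsmul_eq_mul]
    ring

theorem kernelSum_le_pow (β : ℝ) : ∃ K : ℕ, ∀ L : ℕ, kernelSum β (L + 1) ≤ ((L : ℝ) + 1) ^ K := by
  refine ⟨⌈|β|⌉₊ + 1, fun L => ?_⟩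
  have hterm : ∀ i ∈ range (L + 1), ((i : ℝ) + 1) ^ (-β) ≤ ((L : ℝ) + 1) ^ ⌈|β|⌉₊ := by
    intro i hi
    have hi' : (i : ℝ) ≤ L := by exact_mod_cast Nat.lt_succ_iff.1 (mem_range.1 hi)
    have hi0 : (0 : ℝ) ≤ i := Nat.cast_nonneg i
    rw [← Real.rpow_natCast]
    calc ((i : ℝ) + 1) ^ (-β) ≤ ((i : ℝ) + 1) ^ (⌈|β|⌉₊ : ℝ) :=
          Real.rpow_le_rpow_of_exponent_le (by linarith)
            ((neg_le_abs β).trans (Nat.le_ceil _))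
      _ ≤ _ := Real.rpow_le_rpow (by positivity) (by linarith) (by positivity)
  refine (sum_le_sum hterm).trans (le_of_eq ?_)
  simp only [sum_const, card_range, nsmul_eq_mul]
  push_cast
  ring

/-- A sequence of power series with bounded coefficient sums whose squared weighted norms are
of the order of the reciprocals of `kernelSum`. -/
def IsSmall (β : ℝ) (q : ℕ → ℂ⟦X⟧) : Prop :=
  ∃ C : ℝ≥0∞, C ≠ ∞ ∧ ∀ L, coeffSum (q L) ≤ C ∧
    wNormSq β (q L) ≤ C * (ENNReal.ofReal (kernelSum β (L + 1)))⁻¹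

theorem IsSmall.zero (β : ℝ) : IsSmall β fun _ => 0 := ⟨0, by simp [coeffSum, wNormSq]⟩

theorem IsSmall.neg {β : ℝ} {q : ℕ → ℂ⟦X⟧} (hq : IsSmall β q) : IsSmall β fun L => -q L := by
  simpa only [IsSmall, coeffSum_neg, wNormSq_neg] using hq

theorem IsSmall.add {β : ℝ} {q r : ℕ → ℂ⟦X⟧} (hq : IsSmall β q) (hr : IsSmall β r) :
    IsSmall β fun L => q L + r L := by
  obtain ⟨C, hC, hq⟩ := hq
  obtain ⟨D, hD, hr⟩ := hr
  refine ⟨2 * (C + D), by finiteness, fun L => ⟨?_, ?_⟩⟩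
  · refine (coeffSum_add_le _ _).trans ((add_le_add (hq L).1 (hr L).1).trans ?_)
    rw [two_mul]
    exact le_self_add
  · refine (wNormSq_add_le β _ _).trans ?_
    rw [mul_assoc, add_mul]
    gcongr
    exacts [(hq L).2, (hr L).2]

theorem IsSmall.mul {β : ℝ} (hβ : β ≤ 2) {q r : ℕ → ℂ⟦X⟧} (hq : IsSmall β q)
    (hr : IsSmall β r) : IsSmall β fun L => q L * r L := by
  obtain ⟨C, hC, hq⟩ := hq
  obtain ⟨D, hD, hr⟩ := hr
  refine ⟨C * D + 2 * (C ^ 2 * D + D ^ 2 * C), by finiteness, fun L => ⟨?_, ?_⟩⟩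
  · exact (coeffSum_mul_le _ _).trans ((mul_le_mul' (hq L).1 (hr L).1).trans le_self_add)
  · refine (wNormSq_mul_le hβ _ _).trans ?_
    rw [add_mul]
    refine le_trans ?_ le_add_self
    rw [mul_assoc 2, add_mul, mul_assoc, mul_assoc]
    gcongr
    exacts [(hq L).1, (hr L).2, (hr L).1, (hq L).2]

/-- With `x = 1 - q` and `y = 1 - r`, one has `1 - q r = x + y - x y`: approximate inverses of two
factors multiply to one of the product. -/
theorem IsSmall.one_sub_mul {β : ℝ} (hβ : β ≤ 2) {q r : ℕ → ℂ⟦X⟧}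
    (hq : IsSmall β fun L => 1 - q L) (hr : IsSmall β fun L => 1 - r L) :
    IsSmall β fun L => 1 - q L * r L := by
  convert (hq.add hr).add (hq.mul hβ hr).neg using 2
  ring

/-- The normalised truncation of the reproducing kernel at a boundary point. -/
noncomputable def boundaryKernel (β : ℝ) (ζ : ℂ) (L : ℕ) : Polynomial ℂ :=
  ∑ i ∈ range (L + 1), Polynomial.monomial i
    (((((i : ℝ) + 1) ^ (-β) / kernelSum β (L + 1) : ℝ) : ℂ) * (starRingEnd ℂ ζ) ^ i)

theorem coeff_boundaryKernel (β : ℝ) (ζ : ℂ) (L l : ℕ) :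
    (boundaryKernel β ζ L).coeff l = if l < L + 1 then
      ((((l : ℝ) + 1) ^ (-β) / kernelSum β (L + 1) : ℝ) : ℂ) * (starRingEnd ℂ ζ) ^ l else 0 := by
  simp [boundaryKernel, Polynomial.finsetSum_coeff, Polynomial.coeff_monomial]

theorem natDegree_boundaryKernel_le (β : ℝ) (ζ : ℂ) (L : ℕ) :
    (boundaryKernel β ζ L).natDegree ≤ L :=
  Polynomial.natDegree_sum_le_of_forall_le _ _ fun _ hi =>
    (Polynomial.natDegree_monomial_le _).trans (Nat.lt_succ_iff.1 (mem_range.1 hi))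

theorem eval_boundaryKernel (β : ℝ) {ζ : ℂ} (hζ : ‖ζ‖ = 1) (L : ℕ) :
    (boundaryKernel β ζ L).eval ζ = 1 := by
  have h1 : starRingEnd ℂ ζ * ζ = 1 := by
    rw [← Complex.normSq_eq_conj_mul_self, Complex.normSq_eq_norm_sq, hζ]
    norm_num
  have h2 : kernelSum β (L + 1) ≠ 0 := (kernelSum_pos β (Nat.succ_pos L)).ne'
  simp only [boundaryKernel, Polynomial.eval_finsetSum, Polynomial.eval_monomial, mul_assoc,
    ← mul_pow, h1, one_pow, mul_one]
  rw [← Complex.ofReal_sum, ← sum_div, ← kernelSum, div_self h2, Complex.ofReal_one]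

theorem enorm_coeff_boundaryKernel (β : ℝ) {ζ : ℂ} (hζ : ‖ζ‖ = 1) (L l : ℕ) :
    ‖(boundaryKernel β ζ L).coeff l‖ₑ = if l ∈ range (L + 1) then
      ENNReal.ofReal (((l : ℝ) + 1) ^ (-β) / kernelSum β (L + 1)) else 0 := by
  have h2 := kernelSum_pos β (Nat.succ_pos L)
  rw [coeff_boundaryKernel]
  simp only [mem_range]
  split_ifs with h
  · rw [← ofReal_norm, norm_mul, norm_pow, RCLike.norm_conj, hζ, one_pow, mul_one,
      Complex.norm_real, Real.norm_of_nonneg (by positivity)]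
  · simp

/-- Both bounds are equalities with constant `1`, since `(l+1)^β ((l+1)^{-β})² = (l+1)^{-β}` sums to
`kernelSum`, which is divided by its square. -/
theorem isSmall_boundaryKernel (β : ℝ) {ζ : ℂ} (hζ : ‖ζ‖ = 1) :
    IsSmall β fun L => (boundaryKernel β ζ L : ℂ⟦X⟧) := by
  refine ⟨1, by simp, fun L => ⟨le_of_eq ?_, le_of_eq ?_⟩⟩
  · have h2 := kernelSum_pos β (Nat.succ_pos L)
    simp only [coeffSum, Polynomial.coeff_coe, enorm_coeff_boundaryKernel β hζ]
    rw [tsum_eq_sum (s := range (L + 1)) (fun _ hl => if_neg hl),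
      sum_congr rfl (fun _ hl => if_pos hl),
      ← ENNReal.ofReal_sum_of_nonneg (fun i _ => by positivity), ← sum_div, ← kernelSum,
      div_self h2.ne', ENNReal.ofReal_one]
  · have h2 := kernelSum_pos β (Nat.succ_pos L)
    simp only [wNormSq, Polynomial.coeff_coe, enorm_coeff_boundaryKernel β hζ]
    rw [tsum_eq_sum (s := range (L + 1)) (fun l hl => by rw [if_neg hl]; simp)]
    have hterm : ∀ l ∈ range (L + 1), ENNReal.ofReal (((l : ℝ) + 1) ^ β) *
        (if l ∈ range (L + 1) then
          ENNReal.ofReal (((l : ℝ) + 1) ^ (-β) / kernelSum β (L + 1)) else 0) ^ 2 =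
        ENNReal.ofReal (((l : ℝ) + 1) ^ (-β) / kernelSum β (L + 1) ^ 2) := by
      intro l hl
      have hl0 : (0 : ℝ) < (l : ℝ) + 1 := by positivity
      rw [if_pos hl, ← ENNReal.ofReal_pow (by positivity), ← ENNReal.ofReal_mul (by positivity)]
      congr 1
      rw [div_pow, ← mul_div_assoc, sq (((l : ℝ) + 1) ^ (-β)), ← mul_assoc,
        ← Real.rpow_add hl0]
      simp
    rw [sum_congr rfl hterm, ← ENNReal.ofReal_sum_of_nonneg (fun i _ => by positivity),
      ← sum_div, ← kernelSum, one_mul, ← ENNReal.ofReal_inv_of_pos h2]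
    congr 1
    field_simp

/-- One zero at a time: `1 - boundaryKernel` vanishes at `ζ`, and its quotient by `X - ζ` is the
approximate inverse of that factor. Multiple zeros are simply repeated. -/
theorem exists_isSmall_one_sub_mul_prod {β : ℝ} (hβ : β ≤ 2) (s : Multiset ℂ)
    (hs : ∀ ζ ∈ s, ‖ζ‖ = 1) :
    ∃ p : ℕ → Polynomial ℂ, (∀ L, (p L).natDegree ≤ s.card * L) ∧
      IsSmall β fun L => 1 -
        ((p L * (s.map fun ζ => Polynomial.X - Polynomial.C ζ).prod : Polynomial ℂ) : ℂ⟦X⟧) := by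
  induction s using Multiset.induction_on with
  | empty => exact ⟨fun _ => 1, by simp, by simpa using IsSmall.zero β⟩
  | cons ζ s ih =>
    obtain ⟨p, hp, hsm⟩ := ih fun z hz => hs z (Multiset.mem_cons_of_mem hz)
    have hζ := hs ζ (Multiset.mem_cons_self ζ s)
    have hdvd : ∀ L, ∃ r : Polynomial ℂ, r.natDegree ≤ L ∧
        1 - boundaryKernel β ζ L = (Polynomial.X - Polynomial.C ζ) * r := by
      intro L
      obtain ⟨r, hr⟩ := Polynomial.dvd_iff_isRoot.2
        (show (1 - boundaryKernel β ζ L).IsRoot ζ by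
          simp [Polynomial.IsRoot, eval_boundaryKernel β hζ])
      refine ⟨r, ?_, hr⟩
      by_cases hr0 : r = 0
      · simp [hr0]
      have hd : (1 - boundaryKernel β ζ L).natDegree ≤ L :=
        (Polynomial.natDegree_sub_le _ _).trans
          (max_le (by simp) (natDegree_boundaryKernel_le β ζ L))
      rw [hr, Polynomial.natDegree_mul (Polynomial.X_sub_C_ne_zero ζ) hr0] at hd
      omega
    choose r hr1 hr2 using hdvd
    refine ⟨fun L => r L * p L, fun L => ?_, ?_⟩
    · rw [Multiset.card_cons, add_mul, one_mul, add_comm]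
      exact Polynomial.natDegree_mul_le.trans (add_le_add (hr1 L) (hp L))
    · have h1 : IsSmall β fun L => 1 - ((1 - boundaryKernel β ζ L : Polynomial ℂ) : ℂ⟦X⟧) := by
        simpa using isSmall_boundaryKernel β hζ
      convert h1.one_sub_mul hβ hsm using 2 with L
      rw [hr2, Multiset.map_cons, Multiset.prod_cons]
      push_cast
      ring

/-- The sum `∑ (l+1)^K |a_l|`. -/
noncomputable def moment (K : ℕ) (a : ℂ⟦X⟧) : ℝ≥0∞ := ∑' l : ℕ, ((l : ℝ≥0∞) + 1) ^ K * ‖coeff l a‖ₑ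

theorem coeffSum_le_moment (K : ℕ) (a : ℂ⟦X⟧) : coeffSum a ≤ moment K a :=
  ENNReal.tsum_le_tsum fun _ => le_mul_of_one_le_left zero_le (one_le_pow₀ le_add_self)

theorem tsum_sq_le_sq_tsum (x : ℕ → ℝ≥0∞) : ∑' l, x l ^ 2 ≤ (∑' l, x l) ^ 2 := by
  rw [sq (∑' l, x l), ← ENNReal.tsum_mul_left]
  refine ENNReal.tsum_le_tsum fun l => ?_
  rw [sq]
  gcongr
  exact ENNReal.le_tsum l

theorem wNormSq_le_moment_sq {β : ℝ} (hβ : β ≤ 2) (a : ℂ⟦X⟧) : wNormSq β a ≤ moment 1 a ^ 2 := by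
  refine le_trans (ENNReal.tsum_le_tsum fun l => ?_) (tsum_sq_le_sq_tsum _)
  rw [mul_pow, pow_one]
  gcongr
  have h1 : (1 : ℝ) ≤ (l : ℝ) + 1 := by simp
  have h2 : ((l : ℝ≥0∞) + 1) ^ 2 = ENNReal.ofReal (((l : ℝ) + 1) ^ 2) := by
    rw [ENNReal.ofReal_pow (by positivity), ENNReal.ofReal_add (by positivity) (by positivity)]
    simp
  rw [h2]
  refine ENNReal.ofReal_le_ofReal ?_
  rw [← Real.rpow_natCast]
  exact Real.rpow_le_rpow_of_exponent_le h1 (by simpa using hβ)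

theorem moment_sub_trunc_mul_le (v : ℂ⟦X⟧) (K L : ℕ) :
    moment 1 (v - (trunc (L + 1) v : ℂ⟦X⟧)) * ((L : ℝ≥0∞) + 1) ^ K ≤ moment (K + 1) v := by
  rw [moment, moment, ← ENNReal.tsum_mul_right]
  refine ENNReal.tsum_le_tsum fun l => ?_
  rw [map_sub, Polynomial.coeff_coe, coeff_trunc]
  split_ifs with h
  · simp
  · have hl : (L : ℝ≥0∞) ≤ l := by exact_mod_cast (by omega : L ≤ l)
    rw [sub_zero, pow_one, mul_right_comm, pow_succ' _ K]
    gcongr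

/-- The error is the tail of `v` times `u`. All moments of `v` being finite, the tail decays faster
than any power of `L`, while `kernelSum` grows at most like a power. -/
theorem isSmall_one_sub_trunc_mul {β : ℝ} (hβ : β ≤ 2) {u v : ℂ⟦X⟧} (huv : v * u = 1)
    (hu : moment 1 u ≠ ∞) (hv : ∀ K, moment K v ≠ ∞) :
    IsSmall β fun L => 1 - (trunc (L + 1) v : ℂ⟦X⟧) * u := by
  obtain ⟨K, hK⟩ := kernelSum_le_pow β
  have hid : ∀ L, 1 - (trunc (L + 1) v : ℂ⟦X⟧) * u = (v - (trunc (L + 1) v : ℂ⟦X⟧)) * u := by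
    intro L
    rw [sub_mul, huv]
  have hb1 : ∀ L, moment 1 (v - (trunc (L + 1) v : ℂ⟦X⟧)) ≤ moment (K + 1) v := fun L =>
    le_trans (le_mul_of_one_le_right zero_le (one_le_pow₀ le_add_self))
      (moment_sub_trunc_mul_le v K L)
  have hb2 : ∀ L, moment 1 (v - (trunc (L + 1) v : ℂ⟦X⟧)) ^ 2 ≤
      moment (K + 1) v ^ 2 * (ENNReal.ofReal (kernelSum β (L + 1)))⁻¹ := by
    intro L
    have hpos := kernelSum_pos β (Nat.succ_pos L)
    rw [← div_eq_mul_inv, ENNReal.le_div_iff_mul_le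
      (Or.inl (by simpa using hpos)) (Or.inl ENNReal.ofReal_ne_top)]
    have h1 : ENNReal.ofReal (kernelSum β (L + 1)) ≤ ((L : ℝ≥0∞) + 1) ^ K := by
      refine (ENNReal.ofReal_le_ofReal (hK L)).trans (le_of_eq ?_)
      rw [ENNReal.ofReal_pow (by positivity), ENNReal.ofReal_add (by positivity) (by positivity)]
      simp
    calc _ ≤ moment 1 (v - (trunc (L + 1) v : ℂ⟦X⟧)) ^ 2 * (((L : ℝ≥0∞) + 1) ^ K) ^ 2 := by
          gcongr
          exact h1.trans (le_self_pow₀ (one_le_pow₀ le_add_self) two_ne_zero)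
      _ ≤ _ := by
          rw [← mul_pow]
          gcongr
          exact moment_sub_trunc_mul_le v K L
  have hw := hv (K + 1)
  simp only [hid]
  refine ⟨moment (K + 1) v * moment 1 u +
    4 * (moment (K + 1) v ^ 2 * moment 1 u ^ 2), by finiteness, fun L => ⟨?_, ?_⟩⟩
  · refine (coeffSum_mul_le _ _).trans ((mul_le_mul' ?_ ?_).trans le_self_add)
    · exact (coeffSum_le_moment 1 _).trans (hb1 L)
    · exact coeffSum_le_moment 1 u
  · set t := v - (trunc (L + 1) v : ℂ⟦X⟧)
    refine (wNormSq_mul_le hβ _ _).trans ?_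
    rw [add_mul]
    refine le_trans ?_ le_add_self
    calc 2 * (coeffSum t ^ 2 * wNormSq β u + coeffSum u ^ 2 * wNormSq β t)
        ≤ 2 * (moment 1 t ^ 2 * moment 1 u ^ 2 + moment 1 u ^ 2 * moment 1 t ^ 2) := by
          gcongr
          exacts [coeffSum_le_moment 1 t, wNormSq_le_moment_sq hβ u, coeffSum_le_moment 1 u,
            wNormSq_le_moment_sq hβ t]
      _ = 4 * (moment 1 t ^ 2 * moment 1 u ^ 2) := by ring
      _ ≤ 4 * (moment (K + 1) v ^ 2 * (ENNReal.ofReal (kernelSum β (L + 1)))⁻¹ *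
            moment 1 u ^ 2) := by
          gcongr
          exact hb2 L
      _ = _ := by ring

/-- One-variable upper bound for the distance to `1`. -/
theorem exists_wNormSq_one_sub_mul_le {β : ℝ} (hβ : β ≤ 2) (s : Multiset ℂ)
    (hs : ∀ ζ ∈ s, ‖ζ‖ = 1) {u v : ℂ⟦X⟧} (huv : v * u = 1)
    (hu : moment 1 u ≠ ∞) (hv : ∀ K, moment K v ≠ ∞) :
    ∃ C : ℝ≥0∞, C ≠ ∞ ∧ ∀ L : ℕ, ∃ p : Polynomial ℂ, p.natDegree ≤ (s.card + 1) * L ∧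
      wNormSq β (1 - (p : ℂ⟦X⟧) *
        (((s.map fun ζ => Polynomial.X - Polynomial.C ζ).prod : Polynomial ℂ) * u)) ≤
        C * (ENNReal.ofReal (kernelSum β (L + 1)))⁻¹ := by
  obtain ⟨p, hp, hsm⟩ := exists_isSmall_one_sub_mul_prod hβ s hs
  obtain ⟨C, hC, h⟩ := hsm.one_sub_mul hβ (isSmall_one_sub_trunc_mul hβ huv hu hv)
  refine ⟨C, hC, fun L => ⟨p L * trunc (L + 1) v, ?_, ?_⟩⟩
  · rw [add_mul, one_mul]
    exact Polynomial.natDegree_mul_le.trans (add_le_add (hp L)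
      (Nat.lt_succ_iff.1 (natDegree_trunc_lt v L)))
  · convert (h L).2 using 3
    push_cast
    ring

end DirichletBall

/-! ### One-variable lower bound. -/

namespace DirichletBall

open PowerSeries Finset

/-- Cauchy–Schwarz with the dual weights `(l+1)^{-β}` and `(l+1)^β`. -/
theorem sum_enorm_coeff_sq_le (β : ℝ) (y : ℂ⟦X⟧) (n : ℕ) :
    (∑ l ∈ range n, ‖coeff l y‖ₑ) ^ 2 ≤ ENNReal.ofReal (kernelSum β n) * wNormSq β y := by
  set w : ℕ → ℝ≥0∞ := fun l => ENNReal.ofReal (((l : ℝ) + 1) ^ (-β))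
  set t : ℕ → ℝ≥0∞ := fun l => ENNReal.ofReal (((l : ℝ) + 1) ^ β)
  have hwt : ∀ l, w l * t l = 1 := by
    intro l
    have hl : (0 : ℝ) < (l : ℝ) + 1 := by positivity
    rw [← ENNReal.ofReal_mul (by positivity), ← Real.rpow_add hl]
    simp
  have h := sq_sum_mul_le (range n) w fun l => t l * ‖coeff l y‖ₑ
  calc _ = (∑ l ∈ range n, w l * (t l * ‖coeff l y‖ₑ)) ^ 2 := by
        simp only [← mul_assoc, hwt, one_mul]
    _ ≤ _ := h
    _ = ENNReal.ofReal (kernelSum β n) * ∑ l ∈ range n, t l * ‖coeff l y‖ₑ ^ 2 := by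
        rw [kernelSum, ENNReal.ofReal_sum_of_nonneg (fun i _ => by positivity)]
        congr 1
        refine sum_congr rfl fun l _ => ?_
        rw [mul_pow, sq (t l), ← mul_assoc, ← mul_assoc, hwt, one_mul]
    _ ≤ _ := by
        gcongr
        exact ENNReal.sum_le_tsum _

/-- Coefficients of `v * y` below `n` see only those of `y` below `n`, so `y` may be cut off before
applying the `ℓ¹` product bound. -/
theorem sum_enorm_coeff_mul_le (v y : ℂ⟦X⟧) (n : ℕ) :
    ∑ l ∈ range n, ‖coeff l (v * y)‖ₑ ≤ coeffSum v * ∑ l ∈ range n, ‖coeff l y‖ₑ := by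
  have h1 : ∀ l ∈ range n, ‖coeff l (v * y)‖ₑ ≤ ∑ ij ∈ antidiagonal l,
      ‖coeff ij.1 v‖ₑ * (if ij.2 ∈ range n then ‖coeff ij.2 y‖ₑ else 0) := by
    intro l hl
    refine (enorm_coeff_mul_le v y l).trans (le_of_eq (sum_congr rfl fun ij hij => ?_))
    rw [if_pos (mem_range.2 (by have := mem_antidiagonal.1 hij; have := mem_range.1 hl; omega))]
  calc _ ≤ ∑ l ∈ range n, ∑ ij ∈ antidiagonal l,
      ‖coeff ij.1 v‖ₑ * (if ij.2 ∈ range n then ‖coeff ij.2 y‖ₑ else 0) := sum_le_sum h1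
    _ ≤ ∑' l, ∑ ij ∈ antidiagonal l,
      ‖coeff ij.1 v‖ₑ * (if ij.2 ∈ range n then ‖coeff ij.2 y‖ₑ else 0) :=
        ENNReal.sum_le_tsum _
    _ = coeffSum v * ∑ l ∈ range n, ‖coeff l y‖ₑ := by
        rw [tsum_mul_tsum_antidiagonal (fun i => ‖coeff i v‖ₑ)
          (fun j => if j ∈ range n then ‖coeff j y‖ₑ else 0), coeffSum]
        congr 1
        rw [tsum_eq_sum (s := range n) (fun _ hl => if_neg hl),
          sum_congr rfl (fun _ hl => if_pos hl)]

theorem summable_norm_coeff_mul_pow {v : ℂ⟦X⟧} (hv : coeffSum v ≠ ∞) {ζ : ℂ} (hζ : ‖ζ‖ = 1) :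
    Summable fun l => ‖coeff l v * ζ ^ l‖ := by
  simpa [hζ] using tsum_enorm_ne_top_iff_summable_norm.1 hv

/-- Both series converge absolutely on the circle, so their Cauchy product gives `v(ζ) u(ζ) = 1`. -/
theorem tsum_coeff_mul_pow_ne_zero {u v : ℂ⟦X⟧} (huv : v * u = 1) (hu : coeffSum u ≠ ∞)
    (hv : coeffSum v ≠ ∞) {ζ : ℂ} (hζ : ‖ζ‖ = 1) : ∑' l, coeff l v * ζ ^ l ≠ 0 := by
  intro h0
  have h := tsum_mul_tsum_eq_tsum_sum_antidiagonal_of_summable_norm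
    (summable_norm_coeff_mul_pow hv hζ) (summable_norm_coeff_mul_pow hu hζ)
  have h1 : ∀ l, ∑ ij ∈ antidiagonal l, coeff ij.1 v * ζ ^ ij.1 * (coeff ij.2 u * ζ ^ ij.2) =
      if l = 0 then 1 else 0 := by
    intro l
    have : ∀ ij ∈ antidiagonal l, coeff ij.1 v * ζ ^ ij.1 * (coeff ij.2 u * ζ ^ ij.2) =
        coeff ij.1 v * coeff ij.2 u * ζ ^ l := by
      intro ij hij
      rw [← mem_antidiagonal.1 hij, pow_add]
      ring
    rw [sum_congr rfl this, ← sum_mul, ← coeff_mul, huv, coeff_one]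
    split_ifs with hl
    · simp [hl]
    · simp
  simp only [h0, zero_mul, h1, tsum_ite_eq] at h
  exact zero_ne_one h

/-- One-variable lower bound for the distance to `1`. -/
theorem exists_le_wNormSq_one_sub_mul (β : ℝ) {P : Polynomial ℂ} {ζ : ℂ} (hζ : ‖ζ‖ = 1)
    (hP : P.eval ζ = 0) {u v : ℂ⟦X⟧} (huv : v * u = 1)
    (hu : coeffSum u ≠ ∞) (hv : coeffSum v ≠ ∞) :
    ∃ c : ℝ≥0∞, c ≠ 0 ∧ c ≠ ∞ ∧ ∀ N : ℕ, ∀ q : Polynomial ℂ, q.natDegree ≤ N →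
      c * (ENNReal.ofReal (kernelSum β (N + 1)))⁻¹ ≤
        wNormSq β (1 - (q : ℂ⟦X⟧) * ((P : ℂ⟦X⟧) * u)) := by
  set T : ℂ := ∑' l, coeff l v * ζ ^ l with hT
  have hT0 : 0 < ‖T‖ := norm_pos_iff.2 (tsum_coeff_mul_pow_ne_zero huv hu hv hζ)
  have hlim := (summable_norm_coeff_mul_pow hv hζ).of_norm.hasSum.tendsto_sum_nat.norm
  obtain ⟨D, hD⟩ := Filter.eventually_atTop.1 (hlim.eventually (lt_mem_nhds (half_lt_self hT0)))
  -- Chosen so that `n = J (N + 1)` exceeds the degree of `q P` and is at least `D`, beyond which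
  -- partial sums of `v` at `ζ` have modulus above half the limit.
  set J := P.natDegree + 1 + D with hJ
  have hJ0 : 0 < J := by omega
  obtain ⟨C, hC, hCK⟩ := kernelSum_mul_le β hJ0
  set δ : ℝ≥0∞ := ENNReal.ofReal (‖T‖ / 2) with hδ
  have hδ0 : δ ≠ 0 := by simpa [hδ] using hT0
  have hδt : δ ≠ ∞ := ENNReal.ofReal_ne_top
  set A : ℝ≥0∞ := coeffSum v ^ 2 * ENNReal.ofReal C with hA
  have hAt : A ≠ ∞ := by finiteness
  have hv0 : coeffSum v ≠ 0 := by
    intro h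
    refine tsum_coeff_mul_pow_ne_zero huv hu hv hζ ?_
    simp only [coeffSum, ENNReal.tsum_eq_zero, enorm_eq_zero] at h
    simp [h]
  have hA0 : A ≠ 0 := mul_ne_zero (pow_ne_zero 2 hv0) (by simpa using hC)
  refine ⟨δ ^ 2 * A⁻¹, mul_ne_zero (pow_ne_zero 2 hδ0) (ENNReal.inv_ne_zero.2 hAt), by finiteness,
    fun N q hq => ?_⟩
  set y : ℂ⟦X⟧ := 1 - (q : ℂ⟦X⟧) * ((P : ℂ⟦X⟧) * u) with hy
  set n := J * (N + 1) with hn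
  have hnD : D ≤ n := by nlinarith
  have hdeg : (q * P).natDegree < n := by
    have := Polynomial.natDegree_mul_le (p := q) (q := P)
    nlinarith
  have hvy : v * y = v - ((q * P : Polynomial ℂ) : ℂ⟦X⟧) := by
    rw [hy, Polynomial.coe_mul]
    linear_combination (-(q : ℂ⟦X⟧) * (P : ℂ⟦X⟧)) * huv
  -- The partial sum up to `n` contains all of `q P`, which vanishes at `ζ`; hence `q` drops out.
  have heval : ∑ l ∈ range n, coeff l (v * y) * ζ ^ l = ∑ l ∈ range n, coeff l v * ζ ^ l := by
    have h0 : (q * P).eval ζ = 0 := by simp [hP]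
    rw [Polynomial.eval_eq_sum_range' hdeg] at h0
    simp only [hvy, map_sub, Polynomial.coeff_coe, sub_mul, sum_sub_distrib, h0, sub_zero]
  have h1 : δ ≤ ∑ l ∈ range n, ‖coeff l (v * y)‖ₑ := by
    calc δ ≤ ‖∑ l ∈ range n, coeff l v * ζ ^ l‖ₑ := by
          rw [hδ, ← ofReal_norm]
          exact ENNReal.ofReal_le_ofReal (hD n hnD).le
      _ ≤ _ := by
          rw [← heval]
          refine (enorm_sum_le _ _).trans (le_of_eq (sum_congr rfl fun l _ => ?_))
          rw [← ofReal_norm, ← ofReal_norm, norm_mul, norm_pow, hζ, one_pow, mul_one]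
  have hpos := kernelSum_pos β (Nat.succ_pos N)
  have h2 : δ ^ 2 ≤ A * (ENNReal.ofReal (kernelSum β (N + 1)) * wNormSq β y) := by
    calc δ ^ 2 ≤ (coeffSum v * ∑ l ∈ range n, ‖coeff l y‖ₑ) ^ 2 := by
          gcongr
          exact h1.trans (sum_enorm_coeff_mul_le v y n)
      _ ≤ coeffSum v ^ 2 * (ENNReal.ofReal (kernelSum β n) * wNormSq β y) := by
          rw [mul_pow]
          gcongr
          exact sum_enorm_coeff_sq_le β y n
      _ ≤ coeffSum v ^ 2 * (ENNReal.ofReal (C * kernelSum β (N + 1)) * wNormSq β y) := by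
          gcongr
          exact hCK (N + 1)
      _ = _ := by rw [ENNReal.ofReal_mul hC.le, hA]; ring
  have hk0 : ENNReal.ofReal (kernelSum β (N + 1)) ≠ 0 := by simpa using hpos
  rw [← div_eq_mul_inv, ← div_eq_mul_inv,
    ENNReal.div_le_iff_le_mul (Or.inl hk0) (Or.inl ENNReal.ofReal_ne_top),
    ENNReal.div_le_iff_le_mul (Or.inl hA0) (Or.inl hAt)]
  refine h2.trans (le_of_eq (by ring))

/-! ### Power series as functions on disks. -/

/-- `F(w) = ∑ a_l w^l` on the disk `|w| < r`. -/
def RepresentsOn (r : ℝ) (a : ℂ⟦X⟧) (F : ℂ → ℂ) : Prop :=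
  ∀ w : ℂ, ‖w‖ < r → HasSum (fun l => coeff l a * w ^ l) (F w)

theorem RepresentsOn.mono {r s : ℝ} {a : ℂ⟦X⟧} {F : ℂ → ℂ} (h : RepresentsOn r a F)
    (hs : s ≤ r) : RepresentsOn s a F := fun w hw => h w (hw.trans_le hs)

theorem RepresentsOn.mul {r : ℝ} {a b : ℂ⟦X⟧} {F G : ℂ → ℂ} (ha : RepresentsOn r a F)
    (hb : RepresentsOn r b G) : RepresentsOn r (a * b) fun w => F w * G w := by
  intro w hw
  have hsa := (ha w hw).summable.norm
  have hsb := (hb w hw).summable.norm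
  have h := tsum_mul_tsum_eq_tsum_sum_antidiagonal_of_summable_norm hsa hsb
  have hs := (summable_norm_sum_mul_antidiagonal_of_summable_norm hsa hsb).of_norm.hasSum
  rw [← h, (ha w hw).tsum_eq, (hb w hw).tsum_eq] at hs
  refine (congrArg (HasSum · (F w * G w)) (funext fun l => ?_)).mpr hs
  rw [coeff_mul, sum_mul]
  refine sum_congr rfl fun ij hij => ?_
  rw [← mem_antidiagonal.1 hij, pow_add]
  ring

theorem representsOn_polynomial (r : ℝ) (p : Polynomial ℂ) :
    RepresentsOn r (p : ℂ⟦X⟧) fun w => p.eval w := by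
  intro w _
  simp only [Polynomial.coeff_coe]
  rw [Polynomial.eval_eq_sum_range]
  refine hasSum_sum_of_ne_finset_zero fun l hl => ?_
  rw [Polynomial.coeff_eq_zero_of_natDegree_lt (by simpa using hl), zero_mul]

theorem RepresentsOn.unique {r : ℝ} (hr : 0 < r) {a b : ℂ⟦X⟧} {F : ℂ → ℂ}
    (ha : RepresentsOn r a F) (hb : RepresentsOn r b F) : a = b := by
  have key : ∀ c : ℂ⟦X⟧, RepresentsOn r c F →
      HasFPowerSeriesAt F (FormalMultilinearSeries.ofScalars ℂ fun l => coeff l c) 0 := by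
    intro c hc
    rw [hasFPowerSeriesAt_iff]
    filter_upwards [Metric.ball_mem_nhds (0 : ℂ) hr] with z hz
    have := hc z (by simpa using hz)
    simpa [FormalMultilinearSeries.coeff_ofScalars, mul_comm] using this
  have h := (key a ha).eq_formalMultilinearSeries (key b hb)
  ext l
  exact congrFun ((FormalMultilinearSeries.ofScalars_series_eq_iff ℂ _ _).1 h) l

theorem exists_representsOn {r : ℝ} {F : ℂ → ℂ} (hF : DifferentiableOn ℂ F (Metric.ball 0 r)) :
    ∃ a : ℂ⟦X⟧, RepresentsOn r a F := by
  refine ⟨PowerSeries.mk fun l => (l.factorial : ℂ)⁻¹ * iteratedDeriv l F 0, fun w hw => ?_⟩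
  have h := Complex.hasSum_taylorSeries_on_ball hF (z := w) (by simpa using hw)
  refine (congrArg (HasSum · (F w)) (funext fun l => ?_)).mpr h
  simp only [coeff_mk, smul_eq_mul, sub_zero]
  ring

/-- For `1 < ρ < r` the series converges absolutely at `ρ`, and `(l+1)^K` is bounded by a multiple
of `ρ^l`. -/
theorem RepresentsOn.moment_ne_top {r : ℝ} (hr : 1 < r) {a : ℂ⟦X⟧} {F : ℂ → ℂ}
    (ha : RepresentsOn r a F) (K : ℕ) : moment K a ≠ ∞ := by
  obtain ⟨ρ, h1, h2⟩ := exists_between hr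
  have hρ : (0 : ℝ) < ρ := by linarith
  have hs := (ha (ρ : ℂ) (by simpa [abs_of_pos hρ] using h2)).summable.norm
  have hlim := (tendsto_pow_const_div_const_pow_of_one_lt K h1).comp (Filter.tendsto_add_atTop_nat 1)
  obtain ⟨B, hB⟩ := hlim.bddAbove_range
  have hle : ∀ l : ℕ, ((l : ℝ) + 1) ^ K ≤ B * ρ ^ (l + 1) := by
    intro l
    have := hB ⟨l, rfl⟩
    simp only [Function.comp] at this
    rw [div_le_iff₀ (by positivity)] at this
    exact_mod_cast this
  have hsum : Summable fun l : ℕ => ‖(((l : ℂ) + 1) ^ K * coeff l a)‖ := by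
    refine Summable.of_nonneg_of_le (fun l => norm_nonneg _) (fun l => ?_) (hs.mul_left (B * ρ))
    have hnorm : ‖(l : ℂ) + 1‖ = (l : ℝ) + 1 := by
      have := Complex.norm_natCast (l + 1)
      push_cast at this
      exact this
    rw [norm_mul, norm_pow, norm_mul, norm_pow, hnorm, Complex.norm_real,
      Real.norm_of_nonneg hρ.le]
    calc ((l : ℝ) + 1) ^ K * ‖coeff l a‖ ≤ B * ρ ^ (l + 1) * ‖coeff l a‖ := by
          gcongr
          exact hle l
      _ = _ := by ring
  convert tsum_enorm_ne_top_iff_summable_norm.2 hsum using 1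
  refine tsum_congr fun l => ?_
  have : ‖(l : ℂ) + 1‖ₑ = (l : ℝ≥0∞) + 1 := by
    rw [← ofReal_norm, ← Nat.cast_succ, Complex.norm_natCast, ENNReal.ofReal_natCast]
    push_cast
    rfl
  rw [enorm_mul, enorm_pow, this]

end DirichletBall

/-! ### Splitting off the boundary zeros. -/

namespace DirichletBall

open PowerSeries Finset Metric

/-- An analytic function on the closed unit disk without zeros in the open disk is a product of
linear factors at boundary points and a zero-free analytic function. -/
theorem exists_boundary_factorization {h : ℂ → ℂ}
    (hh : AnalyticOnNhd ℂ h (closedBall 0 1)) (hne : ∀ w ∈ ball (0 : ℂ) 1, h w ≠ 0) :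
    ∃ (s : Multiset ℂ) (g : ℂ → ℂ), (∀ ζ ∈ s, ‖ζ‖ = 1) ∧ AnalyticOnNhd ℂ g (closedBall 0 1) ∧
      (∀ w ∈ closedBall (0 : ℂ) 1, g w ≠ 0) ∧
      ∀ w ∈ closedBall (0 : ℂ) 1,
        h w = ((s.map fun ζ => Polynomial.X - Polynomial.C ζ).prod : Polynomial ℂ).eval w * g w := by
  have h0K : (0 : ℂ) ∈ closedBall (0 : ℂ) 1 := mem_closedBall_self zero_le_one
  have hpc : IsPreconnected (closedBall (0 : ℂ) 1) := (convex_closedBall 0 1).isPreconnected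
  have hconn : IsConnected (closedBall (0 : ℂ) 1) := ⟨⟨0, h0K⟩, hpc⟩
  have hmer : MeromorphicOn h (closedBall 0 1) := hh.meromorphicOn
  have hord : ∀ u : closedBall (0 : ℂ) 1, meromorphicOrderAt h u ≠ ⊤ := by
    -- Since `h 0 ≠ 0` and the disk is connected, no zero has infinite order.
    refine (hmer.exists_meromorphicOrderAt_ne_top_iff_forall hconn).1 ⟨⟨0, h0K⟩, ?_⟩
    rw [(hh 0 h0K).meromorphicOrderAt_eq,
      (hh 0 h0K).analyticOrderAt_eq_zero.2 (hne 0 (mem_ball_self zero_lt_one))]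
    simp
  set d := MeromorphicOn.divisor h (closedBall 0 1) with hd
  have hfin : d.support.Finite := d.finiteSupport (isCompact_closedBall 0 1)
  obtain ⟨g, hg, hg0, heq⟩ := hmer.extract_zeros_poles hord hfin
  have hdnn : ∀ u, 0 ≤ d u := fun u => (MeromorphicOn.AnalyticOnNhd.divisor_nonneg hh) u
  set s : Multiset ℂ := hfin.toFinset.val.bind fun u => Multiset.replicate (d u).toNat u with hs
  set P : Polynomial ℂ := (s.map fun ζ => Polynomial.X - Polynomial.C ζ).prod with hP
  have hPeval : ∀ w, P.eval w = ∏ u ∈ hfin.toFinset, (w - u) ^ (d u).toNat := by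
    intro w
    rw [hP, hs, Multiset.map_bind, Multiset.prod_bind]
    simp only [Multiset.map_replicate, Multiset.prod_replicate]
    rw [← Finset.prod_eq_multiset_prod, Polynomial.eval_prod]
    simp
  have hfp : ∀ w, (∏ᶠ u, (· - u) ^ d u : ℂ → ℂ) w = P.eval w := by
    intro w
    rw [Function.FactorizedRational.finprod_eq_fun hfin, hPeval]
    beta_reduce
    rw [finprod_eq_prod_of_mulSupport_subset (s := hfin.toFinset)]
    · refine prod_congr rfl fun u _ => ?_
      rw [← zpow_natCast, Int.toNat_of_nonneg (hdnn u)]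
    · intro u hu
      simp only [Set.Finite.coe_toFinset]
      intro h0
      exact hu (by simp [h0])
  have hPg : AnalyticOnNhd ℂ (fun w => P.eval w * g w) (closedBall 0 1) :=
    ((AnalyticOnNhd.eval_polynomial P).mono (Set.subset_univ _)).mul hg
  -- The extraction gives equality only off a discrete set; the identity theorem extends it to the
  -- whole closed disk.
  have hfac : Set.EqOn h (fun w => P.eval w * g w) (closedBall 0 1) := by
    refine hh.eqOn_of_preconnected_of_frequently_eq hPg hpc h0K (Filter.Eventually.frequently ?_)
    have h1 := mem_codiscreteWithin_iff_forall_mem_nhdsNE.1 heq 0 h0K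
    filter_upwards [h1, mem_nhdsWithin_of_mem_nhds (closedBall_mem_nhds (0 : ℂ) zero_lt_one)]
      with w hw hwK
    rcases hw with hw | hw
    · have hw' : h w = ((∏ᶠ u, (· - u) ^ d u : ℂ → ℂ) • g) w := hw
      rw [hw', Pi.smul_apply', hfp, smul_eq_mul]
    · exact absurd hwK hw
  refine ⟨s, g, fun ζ hζ => ?_, hg, fun w hw => hg0 ⟨w, hw⟩, hfac⟩
  have hdζ : d ζ ≠ 0 := by
    obtain ⟨u, _, hu⟩ := Multiset.mem_bind.1 hζ
    have h1 := Multiset.eq_of_mem_replicate hu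
    subst h1
    intro h0
    simp [h0] at hu
  have hζK : ζ ∈ closedBall (0 : ℂ) 1 := d.supportWithinDomain hdζ
  have hPζ : P.eval ζ = 0 := by
    rw [hP, Polynomial.eval_multiset_prod, Multiset.prod_eq_zero_iff]
    simp only [Multiset.map_map, Multiset.mem_map, Function.comp]
    exact ⟨ζ, hζ, by simp⟩
  have hhζ : h ζ = 0 := by simp [hfac hζK, hPζ]
  have h1 : ¬ ‖ζ‖ < 1 := fun hlt => hne ζ (by simpa using hlt) hhζ
  have h2 : ‖ζ‖ ≤ 1 := by simpa using hζK
  exact le_antisymm h2 (not_lt.1 h1)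

/-- Analyticity and non-vanishing are open conditions, and by compactness they persist on a
thickening of the closed disk, which is a larger ball. -/
theorem exists_ball_analytic_ne_zero {g : ℂ → ℂ} (hg : AnalyticOnNhd ℂ g (closedBall 0 1))
    (hg0 : ∀ w ∈ closedBall (0 : ℂ) 1, g w ≠ 0) :
    ∃ R : ℝ, 1 < R ∧ DifferentiableOn ℂ g (ball 0 R) ∧ ∀ w ∈ ball (0 : ℂ) R, g w ≠ 0 := by
  have hopen : IsOpen {w | AnalyticAt ℂ g w ∧ g w ≠ 0} := by
    rw [isOpen_iff_mem_nhds]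
    rintro w ⟨h1, h2⟩
    filter_upwards [h1.eventually_analyticAt, h1.continuousAt.eventually_ne h2] with z hz1 hz2
    exact ⟨hz1, hz2⟩
  obtain ⟨δ, hδ, hsub⟩ := (isCompact_closedBall (0 : ℂ) 1).exists_thickening_subset_open hopen
    fun w hw => ⟨hg w hw, hg0 w hw⟩
  rw [thickening_closedBall hδ zero_le_one] at hsub
  exact ⟨δ + 1, by linarith, fun w hw => (hsub hw).1.differentiableAt.differentiableWithinAt,
    fun w hw => (hsub hw).2⟩

/-- The data extracted from a function with boundary zeros. -/
theorem exists_series_factorization {h : ℂ → ℂ}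
    (hh : AnalyticOnNhd ℂ h (closedBall 0 1)) (hne : ∀ w ∈ ball (0 : ℂ) 1, h w ≠ 0)
    (hz : ∃ w ∈ sphere (0 : ℂ) 1, h w = 0) :
    ∃ (s : Multiset ℂ) (u v : ℂ⟦X⟧), (∀ ζ ∈ s, ‖ζ‖ = 1) ∧ s ≠ 0 ∧ v * u = 1 ∧
      (∀ K, moment K u ≠ ∞) ∧ (∀ K, moment K v ≠ ∞) ∧
      RepresentsOn 1
        (((s.map fun ζ => Polynomial.X - Polynomial.C ζ).prod : Polynomial ℂ) * u) h := by
  obtain ⟨s, g, hs, hg, hg0, hfac⟩ := exists_boundary_factorization hh hne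
  obtain ⟨R, hR, hgd, hgR⟩ := exists_ball_analytic_ne_zero hg hg0
  obtain ⟨u, hu⟩ := exists_representsOn hgd
  obtain ⟨v, hv⟩ := exists_representsOn (hgd.inv hgR)
  have hR0 : 0 < R := by linarith
  refine ⟨s, u, v, hs, ?_, ?_, hu.moment_ne_top hR, hv.moment_ne_top hR, ?_⟩
  -- Without linear factors `h` would equal the zero-free `g`, against the boundary zero.
  · rintro rfl
    obtain ⟨w, hw, hw0⟩ := hz
    have hwK := sphere_subset_closedBall hw
    have := hfac w hwK
    simp [hw0] at this
    exact hg0 w hwK this.symm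
  · refine (hv.mul hu).unique hR0 (b := 1) fun w hw => ?_
    have h1 : (g⁻¹) w * g w = 1 := inv_mul_cancel₀ (hgR w (by simpa using hw))
    have h2 := representsOn_polynomial R 1 w hw
    beta_reduce
    rw [h1]
    simpa using h2
  · intro w hw
    rw [hfac w (by simpa using hw.le)]
    exact (representsOn_polynomial 1 _).mul (hu.mono hR.le) w hw

end DirichletBall

/-! ### Stirling asymptotics of the weight on the diagonal. -/

namespace DirichletBall

open Finset Filter Asymptotics

/-- The exponents of the monomial `(z_1^{M_1} ⋯ z_m^{M_m})^l`. -/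
def diagExp {n : ℕ} (M : Fin n → ℕ) (m l : ℕ) : Fin n → ℕ :=
  fun i => if i ∈ firstIdx n m then l * M i else 0

theorem card_firstIdx {n m : ℕ} (hmn : m ≤ n) : (firstIdx n m).card = m := by
  rw [firstIdx, Fin.card_filter_val_lt, min_eq_right hmn]

theorem sum_diagExp {n : ℕ} (M : Fin n → ℕ) (m l : ℕ) :
    ∑ i, diagExp M m l i = l * ∑ i ∈ firstIdx n m, M i := by
  simp only [diagExp, sum_ite_mem, univ_inter, mul_sum]

theorem prod_factorial_diagExp {n : ℕ} (M : Fin n → ℕ) (m l : ℕ) :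
    ∏ i, ((diagExp M m l i).factorial : ℝ) = ∏ i ∈ firstIdx n m, ((l * M i).factorial : ℝ) := by
  rw [← prod_subset (subset_univ (firstIdx n m))]
  · exact prod_congr rfl fun i hi => by rw [diagExp, if_pos hi]
  · intro i _ hi
    rw [diagExp, if_neg hi]
    simp

theorem isTheta_mul_add_succ {a : ℝ} (ha : 0 < a) {b : ℝ} (hb : 0 ≤ b) :
    (fun l : ℕ => (l : ℝ) * a + b) =Θ[atTop] fun l : ℕ => (l : ℝ) + 1 := by
  constructor
  · refine IsBigO.of_bound (a + b) (Eventually.of_forall fun l => ?_)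
    have hl : (0 : ℝ) ≤ l := Nat.cast_nonneg l
    rw [Real.norm_of_nonneg (by positivity), Real.norm_of_nonneg (by positivity)]
    nlinarith [mul_nonneg hb hl]
  · refine IsBigO.of_bound (2 / a) ((eventually_ge_atTop 1).mono fun l hl => ?_)
    have hl : (1 : ℝ) ≤ l := by exact_mod_cast hl
    rw [Real.norm_of_nonneg (by positivity), Real.norm_of_nonneg (by positivity),
      div_mul_eq_mul_div, le_div_iff₀ ha]
    nlinarith

/-- Stirling at `l a`, with `(l a / e)^{l a}` split into `((l/e)^l)^a` and `(a^a)^l`. In the weight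
the first kind cancels, because the `M i` add up to `S`; the second kind produces `μ^{-l}`. -/
theorem isTheta_factorial_mul {a : ℕ} (ha : 0 < a) :
    (fun l : ℕ => ((l * a).factorial : ℝ)) =Θ[atTop] fun l : ℕ =>
      ((l : ℝ) + 1) ^ (1 / 2 : ℝ) * ((((l : ℝ) / Real.exp 1) ^ l) ^ a * ((a : ℝ) ^ a) ^ l) := by
  have ht : Tendsto (fun l : ℕ => l * a) atTop atTop := tendsto_id.atTop_mul_const' ha
  have h0 := Stirling.factorial_isEquivalent_stirling.isTheta
  have h1 : _ =Θ[atTop] _ := ⟨h0.1.comp_tendsto ht, h0.2.comp_tendsto ht⟩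
  refine IsTheta.trans h1 ?_
  refine IsTheta.mul ?_ (EventuallyEq.isTheta (Eventually.of_forall fun l => ?_))
  · have h2 := (isTheta_mul_add_succ (a := 2 * a * Real.pi) (by positivity) le_rfl).rpow
      (r := 1 / 2) (Eventually.of_forall fun l => by positivity)
      (Eventually.of_forall fun l => by positivity)
    refine IsTheta.trans (EventuallyEq.isTheta (Eventually.of_forall fun l => ?_)) h2
    simp only [Real.sqrt_eq_rpow]
    push_cast
    congr 1
    ring
  · push_cast
    rw [← pow_mul, ← pow_mul, mul_comm a l, ← mul_pow]
    congr 1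
    ring

/-- The quotient of the factorials is a product of `r` factors, each of order `l + 1`. -/
theorem isTheta_factorial_add {S : ℕ} (hS : 0 < S) (r : ℕ) :
    (fun l : ℕ => ((r + l * S).factorial : ℝ)) =Θ[atTop] fun l : ℕ =>
      ((l : ℝ) + 1) ^ r * ((l * S).factorial : ℝ) := by
  have hS' : (0 : ℝ) < S := by exact_mod_cast hS
  constructor
  · have h1 : (fun l : ℕ => ((r + l * S).factorial : ℝ)) =O[atTop] fun l : ℕ =>
        ((l : ℝ) * S + r) ^ r * ((l * S).factorial : ℝ) := by
      refine IsBigO.of_bound 1 (Eventually.of_forall fun l => ?_)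
      rw [Real.norm_of_nonneg (by positivity), Real.norm_of_nonneg (by positivity), one_mul,
        add_comm r, ← Nat.factorial_mul_ascFactorial]
      have := Nat.ascFactorial_le_pow_add (l * S) r
      have h2 : (((l * S + 1).ascFactorial r : ℕ) : ℝ) ≤ ((l : ℝ) * S + r) ^ r := by
        exact_mod_cast this
      push_cast
      rw [mul_comm]
      gcongr
    exact h1.trans (((isTheta_mul_add_succ hS' (Nat.cast_nonneg r)).1.pow r).mul (isBigO_refl _ _))
  · have h1 : (fun l : ℕ => ((l : ℝ) * S + 1) ^ r * ((l * S).factorial : ℝ)) =O[atTop]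
        fun l : ℕ => ((r + l * S).factorial : ℝ) := by
      refine IsBigO.of_bound 1 (Eventually.of_forall fun l => ?_)
      rw [Real.norm_of_nonneg (by positivity), Real.norm_of_nonneg (by positivity), one_mul,
        add_comm r, mul_comm (_ ^ _)]
      exact_mod_cast Nat.factorial_mul_pow_le_factorial (m := l * S) (n := r)
    exact (((isTheta_mul_add_succ hS' zero_le_one).2.pow r).mul (isBigO_refl _ _)).trans h1

theorem mu_pos {n m : ℕ} (M : Fin n → ℕ) (hM : ∀ i ∈ firstIdx n m, 1 ≤ M i) : 0 < mu M m := by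
  rw [mu]
  have h : ∀ i ∈ firstIdx n m, (0 : ℝ) < (M i : ℝ) ^ M i := fun i hi => by
    have : (0 : ℝ) < M i := by exact_mod_cast hM i hi
    positivity
  refine div_pos ?_ (prod_pos h)
  rcases Nat.eq_zero_or_pos (∑ i ∈ firstIdx n m, M i) with h0 | h0
  · simp [h0]
  · have : (0 : ℝ) < (∑ i ∈ firstIdx n m, M i : ℕ) := by exact_mod_cast h0
    positivity

/-- On the diagonal the weight is of the order `μ^{-l} (l+1)^β`. -/
theorem isTheta_weight_diagExp {n m : ℕ} (hm : 1 ≤ m) (hmn : m ≤ n) (M : Fin n → ℕ)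
    (hM : ∀ i ∈ firstIdx n m, 1 ≤ M i) (α : ℝ) :
    (fun l : ℕ => weight n α (diagExp M m l) * mu M m ^ l) =Θ[atTop]
      fun l : ℕ => ((l : ℝ) + 1) ^ betaOf n m α := by
  set S := ∑ i ∈ firstIdx n m, M i with hSdef
  have hcard := card_firstIdx hmn
  have hSpos : 0 < S := by
    have : (firstIdx n m).card ≤ S := by
      rw [card_eq_sum_ones]
      exact sum_le_sum hM
    omega
  have hS' : (0 : ℝ) < S := by exact_mod_cast hSpos
  have hA : (fun l : ℕ => ((n : ℝ) + ((l * S : ℕ) : ℝ)) ^ α) =Θ[atTop]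
      fun l : ℕ => ((l : ℝ) + 1) ^ α := by
    have := (isTheta_mul_add_succ hS' (Nat.cast_nonneg n)).rpow (r := α)
      (Eventually.of_forall fun l => by positivity) (Eventually.of_forall fun l => by positivity)
    refine IsTheta.trans (EventuallyEq.isTheta (Eventually.of_forall fun l => ?_)) this
    push_cast
    congr 1
    ring
  have hB := IsTheta.finsetProd (l := atTop) (s := firstIdx n m)
    (f := fun i (l : ℕ) => ((l * M i).factorial : ℝ)) (fun i hi => isTheta_factorial_mul (hM i hi))
  have hC := (isTheta_factorial_add hSpos (n - 1)).trans
    ((isTheta_refl (fun l : ℕ => ((l : ℝ) + 1) ^ (n - 1)) atTop).mul (isTheta_factorial_mul hSpos))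
  have hall := (((hA.mul ((isTheta_refl (fun _ : ℕ => ((n - 1).factorial : ℝ)) atTop).mul hB)).div
    hC).mul (isTheta_refl (fun l : ℕ => mu M m ^ l) atTop))
  have hfac : ((n - 1).factorial : ℝ) ≠ 0 := by positivity
  have hL : (fun l : ℕ => weight n α (diagExp M m l) * mu M m ^ l) = fun l : ℕ =>
      ((n : ℝ) + ((l * S : ℕ) : ℝ)) ^ α *
        (((n - 1).factorial : ℝ) * ∏ i ∈ firstIdx n m, ((l * M i).factorial : ℝ)) /
          ((n - 1 + l * S).factorial : ℝ) * mu M m ^ l := by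
    funext l
    rw [weight, sum_diagExp, prod_factorial_diagExp]
  rw [hL]
  refine IsTheta.trans hall ?_
  have hfinal : (fun l : ℕ => ((n - 1).factorial : ℝ) * ((l : ℝ) + 1) ^ betaOf n m α) =Θ[atTop]
      fun l : ℕ => ((l : ℝ) + 1) ^ betaOf n m α :=
    (isTheta_refl _ _).const_mul_left hfac
  refine IsTheta.trans (EventuallyEq.isTheta ?_) hfinal
  filter_upwards [eventually_ge_atTop 1] with l hl
  have hl' : (0 : ℝ) < l := by exact_mod_cast hl
  have hl1 : (0 : ℝ) < (l : ℝ) + 1 := by positivity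
  have hMpos : ∀ i ∈ firstIdx n m, ((M i : ℝ) ^ M i) ≠ 0 := fun i hi => by
    have : (0 : ℝ) < M i := by exact_mod_cast hM i hi
    positivity
  have hPi : (∏ i ∈ firstIdx n m, ((M i : ℝ) ^ M i)) ≠ 0 := prod_ne_zero_iff.2 hMpos
  set E : ℝ := ((l : ℝ) / Real.exp 1) ^ l with hE
  have hE0 : E ≠ 0 := by positivity
  have hprod : ∏ i ∈ firstIdx n m,
      (((l : ℝ) + 1) ^ (1 / 2 : ℝ) * (E ^ M i * ((M i : ℝ) ^ M i) ^ l)) =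
      ((l : ℝ) + 1) ^ ((m : ℝ) / 2) * (E ^ S * (∏ i ∈ firstIdx n m, ((M i : ℝ) ^ M i)) ^ l) := by
    rw [prod_mul_distrib, prod_mul_distrib, prod_const, hcard, prod_pow_eq_pow_sum, prod_pow,
      ← Real.rpow_natCast, ← Real.rpow_mul hl1.le]
    congr 2
    ring
  -- The exponent count is `β = α + m/2 - (n-1) - 1/2`: each of the `m` factorials above, and the
  -- one below, contributes a square root.
  have hbeta : ((l : ℝ) + 1) ^ betaOf n m α = ((l : ℝ) + 1) ^ α * ((l : ℝ) + 1) ^ ((m : ℝ) / 2) /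
      (((l : ℝ) + 1) ^ (n - 1) * ((l : ℝ) + 1) ^ (1 / 2 : ℝ)) := by
    rw [← Real.rpow_natCast, ← Real.rpow_add hl1, ← Real.rpow_add hl1, ← Real.rpow_sub hl1,
      betaOf, Nat.cast_sub (hm.trans hmn)]
    congr 1
    push_cast
    ring
  rw [hprod, hbeta, mu, ← hSdef, div_pow]
  have hx1 : ((l : ℝ) + 1) ^ (1 / 2 : ℝ) ≠ 0 := by positivity
  field_simp

theorem exists_weight_diagExp_bounds {n m : ℕ} (hm : 1 ≤ m) (hmn : m ≤ n) (M : Fin n → ℕ)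
    (hM : ∀ i ∈ firstIdx n m, 1 ≤ M i) (α : ℝ) :
    ∃ c C : ℝ, 0 < c ∧ 0 < C ∧ ∀ l : ℕ,
      c * ((l : ℝ) + 1) ^ betaOf n m α ≤ weight n α (diagExp M m l) * mu M m ^ l ∧
        weight n α (diagExp M m l) * mu M m ^ l ≤ C * ((l : ℝ) + 1) ^ betaOf n m α := by
  have h := isTheta_weight_diagExp hm hmn M hM α
  have hmu := mu_pos M hM
  have hn : 0 < n := by omega
  have hn' : (0 : ℝ) < n := by exact_mod_cast hn
  have hw : ∀ l : ℕ, 0 < weight n α (diagExp M m l) * mu M m ^ l := fun l => by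
    rw [weight]
    have : (0 : ℝ) < ∏ i, ((diagExp M m l i).factorial : ℝ) := prod_pos fun i _ => by positivity
    positivity
  obtain ⟨C, hC, h1⟩ := bound_of_isBigO_nat_atTop h.1
  obtain ⟨D, hD, h2⟩ := bound_of_isBigO_nat_atTop h.2
  refine ⟨D⁻¹, C, inv_pos.2 hD, hC, fun l => ⟨?_, ?_⟩⟩
  · have := h2 (hw l).ne'
    rw [Real.norm_of_nonneg (by positivity), Real.norm_of_nonneg (hw l).le] at this
    rw [inv_mul_le_iff₀ hD]
    exact this
  · have hp : (0 : ℝ) < ((l : ℝ) + 1) ^ betaOf n m α := by positivity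
    have := h1 hp.ne'
    rwa [Real.norm_of_nonneg (hw l).le, Real.norm_of_nonneg hp.le] at this

end DirichletBall

/-! ### Growth of `kernelSum`, and the range of the monomial on the ball. -/

namespace DirichletBall

open Finset

theorem sum_range_rpow_sub {s : ℝ} (hs : 0 < s) (n : ℕ) :
    ∑ i ∈ range n, (((i : ℝ) + 1) ^ s - (i : ℝ) ^ s) = (n : ℝ) ^ s := by
  have h := sum_range_sub (fun i : ℕ => (i : ℝ) ^ s) n
  simp only [Nat.cast_add, Nat.cast_one, Nat.cast_zero, Real.zero_rpow hs.ne', sub_zero] at h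
  exact h

/-- Prepares Bernoulli's inequality at `-1/(i+1)`, which compares `(i+1)^s - i^s` with `s
(i+1)^{s-1}`. -/
theorem rpow_eq_succ_rpow_mul (s : ℝ) (i : ℕ) :
    (i : ℝ) ^ s = ((i : ℝ) + 1) ^ s * (1 + -((i : ℝ) + 1)⁻¹) ^ s ∧
      ((i : ℝ) + 1) ^ s * (1 + s * -((i : ℝ) + 1)⁻¹) =
        ((i : ℝ) + 1) ^ s - s * ((i : ℝ) + 1) ^ (s - 1) ∧ -1 ≤ -((i : ℝ) + 1)⁻¹ := by
  have hi : (0 : ℝ) < (i : ℝ) + 1 := by positivity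
  have h1 : 1 + -((i : ℝ) + 1)⁻¹ = i / ((i : ℝ) + 1) := by field_simp; ring
  refine ⟨?_, ?_, ?_⟩
  · rw [h1, ← Real.mul_rpow hi.le (by positivity)]
    congr 1
    field_simp
  · rw [Real.rpow_sub_one hi.ne']
    ring
  · rw [neg_le_neg_iff]
    exact inv_le_one_of_one_le₀ (by simp)

/-- One bound compares every term with the last one; the other telescopes after Bernoulli's
inequality. The two exchange roles at `s = 1`. -/
theorem exists_kernelSum_bounds_of_lt {β : ℝ} (hβ : β < 1) :
    ∃ c C : ℝ, 0 < c ∧ 0 < C ∧ ∀ N : ℕ, c * ((N : ℝ) + 1) ^ (1 - β) ≤ kernelSum β (N + 1) ∧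
      kernelSum β (N + 1) ≤ C * ((N : ℝ) + 1) ^ (1 - β) := by
  set s := 1 - β with hs
  have hs0 : 0 < s := by linarith
  have hneg : -β = s - 1 := by rw [hs]; ring
  have htel : ∀ N : ℕ, ∑ i ∈ range (N + 1), (((i : ℝ) + 1) ^ s - (i : ℝ) ^ s) =
      ((N : ℝ) + 1) ^ s := fun N => by
    have := sum_range_rpow_sub hs0 (N + 1)
    push_cast at this
    exact this
  have hconst : ∀ N : ℕ, ∑ _i ∈ range (N + 1), ((N : ℝ) + 1) ^ (s - 1) = ((N : ℝ) + 1) ^ s := by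
    intro N
    have hN : (N : ℝ) + 1 ≠ 0 := by positivity
    rw [sum_const, card_range, nsmul_eq_mul, Real.rpow_sub_one hN]
    push_cast
    field_simp
  have hmem : ∀ {N i : ℕ}, i ∈ range (N + 1) → (i : ℝ) + 1 ≤ (N : ℝ) + 1 := fun hi => by
    have := mem_range.1 hi
    exact_mod_cast this
  simp only [kernelSum, hneg]
  rcases le_total s 1 with h | h
  · refine ⟨1, s⁻¹, one_pos, inv_pos.2 hs0, fun N => ⟨?_, ?_⟩⟩
    · rw [one_mul, ← hconst]
      exact sum_le_sum fun i hi =>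
        Real.rpow_le_rpow_of_nonpos (by positivity) (hmem hi) (by linarith)
    · rw [le_inv_mul_iff₀ hs0, ← htel, mul_sum]
      refine sum_le_sum fun i _ => ?_
      obtain ⟨h1, h2, h3⟩ := rpow_eq_succ_rpow_mul s i
      have h4 := mul_le_mul_of_nonneg_left (rpow_one_add_le_one_add_mul_self h3 hs0.le h)
        (by positivity : (0 : ℝ) ≤ ((i : ℝ) + 1) ^ s)
      rw [h2, ← h1] at h4
      linarith
  · refine ⟨s⁻¹, 1, inv_pos.2 hs0, one_pos, fun N => ⟨?_, ?_⟩⟩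
    · rw [inv_mul_le_iff₀ hs0, ← htel, mul_sum]
      refine sum_le_sum fun i _ => ?_
      obtain ⟨h1, h2, h3⟩ := rpow_eq_succ_rpow_mul s i
      have h4 := mul_le_mul_of_nonneg_left (one_add_mul_self_le_rpow_one_add h3 h)
        (by positivity : (0 : ℝ) ≤ ((i : ℝ) + 1) ^ s)
      rw [h2, ← h1] at h4
      linarith
    · rw [one_mul, ← hconst]
      exact sum_le_sum fun i hi => Real.rpow_le_rpow (by positivity) (hmem hi) (by linarith)

theorem exists_kernelSum_one_bounds :
    ∃ c C : ℝ, 0 < c ∧ 0 < C ∧ ∀ N : ℕ, 1 ≤ N → 0 < Real.log ((N : ℝ) + 1) ∧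
      c * Real.log ((N : ℝ) + 1) ≤ kernelSum 1 (N + 1) ∧
      kernelSum 1 (N + 1) ≤ C * Real.log ((N : ℝ) + 1) := by
  have hlog2 : 0 < Real.log 2 := Real.log_pos one_lt_two
  have hk : ∀ n : ℕ, kernelSum 1 n = (harmonic n : ℝ) := by
    intro n
    rw [kernelSum, harmonic]
    push_cast
    exact sum_congr rfl fun i _ => Real.rpow_neg_one _
  -- The `1` in the harmonic bound `1 + log (N + 1)` is absorbed using `log 2 ≤ log (N + 1)`, hence
  -- `N ≥ 1`.
  refine ⟨1, (Real.log 2)⁻¹ + 1, one_pos, by positivity, fun N hN => ?_⟩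
  have hN' : (1 : ℝ) ≤ N := by exact_mod_cast hN
  have h2 : Real.log 2 ≤ Real.log ((N : ℝ) + 1) := Real.log_le_log two_pos (by linarith)
  refine ⟨hlog2.trans_le h2, ?_, ?_⟩
  · rw [one_mul, hk]
    have h3 := log_add_one_le_harmonic (N + 1)
    refine le_trans (Real.log_le_log (by positivity) ?_) h3
    push_cast
    linarith
  · rw [hk]
    have h3 := harmonic_le_one_add_log (N + 1)
    push_cast at h3
    have h4 : 1 ≤ (Real.log 2)⁻¹ * Real.log ((N : ℝ) + 1) := by
      rw [le_inv_mul_iff₀ hlog2, mul_one]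
      exact h2
    linarith

/-- The function `phi` is comparable with the partial sums of `(i+1)^{-β}`. -/
theorem exists_kernelSum_phi_bounds {β : ℝ} (hβ : β ≤ 1) :
    ∃ c C : ℝ, 0 < c ∧ 0 < C ∧ ∀ N : ℕ, (β = 1 → 1 ≤ N) → 0 < phi β (N + 1) ∧
      c * phi β (N + 1) ≤ kernelSum β (N + 1) ∧ kernelSum β (N + 1) ≤ C * phi β (N + 1) := by
  rcases hβ.lt_or_eq with h | rfl
  · obtain ⟨c, C, hc, hC, hb⟩ := exists_kernelSum_bounds_of_lt h
    refine ⟨c, C, hc, hC, fun N _ => ?_⟩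
    rw [phi, if_pos h]
    exact ⟨by positivity, hb N⟩
  · obtain ⟨c, C, hc, hC, hb⟩ := exists_kernelSum_one_bounds
    refine ⟨c, C, hc, hC, fun N hN => ?_⟩
    have h := hb N (hN rfl)
    rw [phi, if_neg (lt_irrefl 1), max_eq_left h.1.le]
    exact h

theorem tendsto_kernelSum {β : ℝ} (hβ : β ≤ 1) :
    Filter.Tendsto (kernelSum β) Filter.atTop Filter.atTop := by
  refine Filter.tendsto_atTop_mono (fun n => ?_) Real.tendsto_sum_range_one_div_nat_succ_atTop
  refine sum_le_sum fun i _ => ?_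
  rw [one_div, ← Real.rpow_neg_one]
  exact Real.rpow_le_rpow_of_exponent_le (by simp) (by linarith)

/-- The weighted arithmetic-geometric mean inequality on the ball. -/
theorem mu_mul_prod_sq_lt_one {n m : ℕ} (hm : 1 ≤ m) (hmn : m ≤ n) (M : Fin n → ℕ)
    (hM : ∀ i ∈ firstIdx n m, 1 ≤ M i) {z : Cn n} (hz : z ∈ unitBall n) :
    mu M m * (∏ i ∈ firstIdx n m, ‖z i‖ ^ M i) ^ 2 < 1 := by
  set S := ∑ i ∈ firstIdx n m, M i with hSdef
  have hSpos : 0 < S := by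
    have : (firstIdx n m).card ≤ S := by
      rw [card_eq_sum_ones]
      exact sum_le_sum hM
    rw [card_firstIdx hmn] at this
    omega
  have hS' : (0 : ℝ) < S := by exact_mod_cast hSpos
  have hMp : ∀ i ∈ firstIdx n m, (0 : ℝ) < M i := fun i hi => by exact_mod_cast hM i hi
  have hsum : ∑ i ∈ firstIdx n m, ‖z i‖ ^ 2 < 1 := by
    have h1 : ‖z‖ < 1 := by simpa [unitBall] using hz
    have h2 : ‖z‖ ^ 2 < 1 := by nlinarith [norm_nonneg z]
    rw [EuclideanSpace.norm_sq_eq] at h2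
    exact (sum_le_sum_of_subset_of_nonneg (subset_univ _) fun i _ _ => by positivity).trans_lt h2
  have hw : ∑ i ∈ firstIdx n m, (M i : ℝ) / S = 1 := by
    rw [← sum_div, ← Nat.cast_sum, ← hSdef, div_self hS'.ne']
  have hx : ∀ i ∈ firstIdx n m, 0 ≤ ‖z i‖ ^ 2 * S / M i := fun i _ => by positivity
  -- The arithmetic mean of these numbers is `∑ |z_i|²`, and the `S`-th power of their geometric
  -- mean is the left-hand side.
  have hAG := Real.geom_mean_le_arith_mean_weighted (firstIdx n m) (fun i => (M i : ℝ) / S)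
    (fun i => ‖z i‖ ^ 2 * S / M i) (fun i _ => by positivity) hw hx
  have hAG1 : ∏ i ∈ firstIdx n m, (‖z i‖ ^ 2 * S / M i) ^ ((M i : ℝ) / S) < 1 := by
    refine hAG.trans_lt (lt_of_eq_of_lt (sum_congr rfl fun i hi => ?_) hsum)
    have := hMp i hi
    field_simp
  have hpow : (∏ i ∈ firstIdx n m, (‖z i‖ ^ 2 * S / M i) ^ ((M i : ℝ) / S)) ^ S < 1 :=
    pow_lt_one₀ (prod_nonneg fun i hi => Real.rpow_nonneg (hx i hi) _) hAG1 hSpos.ne'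
  refine lt_of_eq_of_lt ?_ hpow
  rw [← prod_pow _ S]
  have hterm : ∀ i ∈ firstIdx n m, ((‖z i‖ ^ 2 * S / M i) ^ ((M i : ℝ) / S)) ^ S =
      (‖z i‖ ^ M i) ^ 2 * (S : ℝ) ^ M i / (M i : ℝ) ^ M i := by
    intro i hi
    rw [← Real.rpow_natCast, ← Real.rpow_mul (hx i hi), div_mul_cancel₀ _ hS'.ne',
      Real.rpow_natCast, div_pow, mul_pow, pow_right_comm]
  rw [prod_congr rfl hterm, prod_div_distrib, prod_mul_distrib, prod_pow_eq_pow_sum, prod_pow,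
    mu, ← hSdef]
  ring

end DirichletBall

/-! ### Expansions in the ball, multipliers and cyclicity. -/

namespace DirichletBall

open Finset

theorem monom_add {n : ℕ} (j k : Fin n → ℕ) (z : Cn n) :
    monom (j + k) z = monom j z * monom k z := by
  simp [monom, pow_add, prod_mul_distrib]

theorem monom_diagExp {n : ℕ} (M : Fin n → ℕ) (m l : ℕ) (z : Cn n) :
    monom (diagExp M m l) z = (∏ i ∈ firstIdx n m, z i ^ M i) ^ l := by
  rw [monom, ← prod_subset (subset_univ (firstIdx n m)), ← prod_pow]
  · exact prod_congr rfl fun i hi => by rw [diagExp, if_pos hi, ← pow_mul, mul_comm]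
  · intro i _ hi
    rw [diagExp, if_neg hi, pow_zero]

theorem HasExpansion.add {n : ℕ} {f g : Cn n → ℂ} {a b : (Fin n → ℕ) → ℂ}
    (ha : HasExpansion f a) (hb : HasExpansion g b) :
    HasExpansion (f + g) (a + b) := fun z hz => by
  simpa [add_mul] using (ha z hz).add (hb z hz)

theorem HasExpansion.const_mul {n : ℕ} {f : Cn n → ℂ} {a : (Fin n → ℕ) → ℂ}
    (ha : HasExpansion f a) (c : ℂ) :
    HasExpansion (fun z => c * f z) (fun k => c * a k) := fun z hz => by
  simpa [mul_assoc] using (ha z hz).mul_left c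

theorem HasExpansion.sum {n : ℕ} {ι : Type*} (s : Finset ι) {f : ι → Cn n → ℂ}
    {a : ι → (Fin n → ℕ) → ℂ} (h : ∀ i ∈ s, HasExpansion (f i) (a i)) :
    HasExpansion (fun z => ∑ i ∈ s, f i z) (fun k => ∑ i ∈ s, a i k) := fun z hz => by
  simpa [sum_mul] using hasSum_sum fun i hi => h i hi z hz

theorem hasExpansion_extend {n : ℕ} {ι : Type*} {e : ι → Fin n → ℕ} (he : Function.Injective e)
    {f : Cn n → ℂ} {b : ι → ℂ}
    (h : ∀ z ∈ unitBall n, HasSum (fun l => b l * monom (e l) z) (f z)) :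
    HasExpansion f (Function.extend e b 0) := fun z hz => by
  rw [← he.hasSum_iff]
  · refine (congrArg (HasSum · (f z)) (funext fun l => ?_)).mpr (h z hz)
    simp [he.extend_apply]
  · intro k hk
    rw [Function.extend_apply' _ _ _ (by simpa using hk)]
    simp

theorem tsum_extend {n : ℕ} {ι : Type*} {e : ι → Fin n → ℕ} (he : Function.Injective e)
    (b : ι → ℂ) (w : (Fin n → ℕ) → ℝ) :
    ∑' k, ENNReal.ofReal (w k * ‖Function.extend e b 0 k‖ ^ 2) =
      ∑' l, ENNReal.ofReal (w (e l) * ‖b l‖ ^ 2) := by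
  rw [← he.tsum_eq]
  · simp [he.extend_apply]
  · intro k hk
    by_contra h
    rw [Function.mem_support, Function.extend_apply' _ _ _ (by simpa using h)] at hk
    simp at hk

theorem HasExpansion.monom_mul {n : ℕ} {f : Cn n → ℂ} {a : (Fin n → ℕ) → ℂ}
    (ha : HasExpansion f a) (j : Fin n → ℕ) :
    HasExpansion (fun z => monom j z * f z) (Function.extend (fun k => j + k) a 0) := by
  refine hasExpansion_extend (add_right_injective j) fun z hz => ?_
  refine (congrArg (HasSum · _) (funext fun l => ?_)).mpr ((ha z hz).mul_left (monom j z))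
  rw [monom_add]
  ring

theorem normSq_eq_top {n : ℕ} (α : ℝ) {f : Cn n → ℂ} (h : ¬ ∃ a, HasExpansion f a) :
    normSq α f = ∞ := by
  simp only [normSq, iInf_eq_top]
  exact fun a ha => absurd ⟨a, ha⟩ h

theorem exists_hasExpansion {n : ℕ} {α : ℝ} {f : Cn n → ℂ} (h : normSq α f ≠ ∞) :
    ∃ a, HasExpansion f a := by
  by_contra h'
  exact h (normSq_eq_top α h')

theorem weight_nonneg (n : ℕ) (α : ℝ) (k : Fin n → ℕ) : 0 ≤ weight n α k := by
  rw [weight]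
  have : (0 : ℝ) ≤ ∏ i, ((k i).factorial : ℝ) := prod_nonneg fun i _ => by positivity
  positivity

theorem normSq_add_le {n : ℕ} (α : ℝ) (f g : Cn n → ℂ) :
    normSq α (f + g) ≤ 2 * (normSq α f + normSq α g) := by
  by_cases hf : ∃ a, HasExpansion f a
  swap
  · simp [normSq_eq_top α hf]
  by_cases hg : ∃ b, HasExpansion g b
  swap
  · simp [normSq_eq_top α hg]
  obtain ⟨a, ha⟩ := hf
  obtain ⟨b, hb⟩ := hg
  rw [normSq_eq α ha, normSq_eq α hb, normSq_eq α (ha.add hb), ← ENNReal.tsum_add,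
    ← ENNReal.tsum_mul_left]
  refine ENNReal.tsum_le_tsum fun k => ?_
  have hw := weight_nonneg n α k
  rw [← ENNReal.ofReal_add (by positivity) (by positivity),
    ← ENNReal.ofReal_ofNat, ← ENNReal.ofReal_mul (by norm_num)]
  refine ENNReal.ofReal_le_ofReal ?_
  have h1 : ‖a k + b k‖ ^ 2 ≤ 2 * (‖a k‖ ^ 2 + ‖b k‖ ^ 2) := by
    have h2 := norm_add_le (a k) (b k)
    nlinarith [norm_nonneg (a k + b k), sq_nonneg (‖a k‖ - ‖b k‖)]
  rw [Pi.add_apply]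
  nlinarith [mul_le_mul_of_nonneg_left h1 hw]

/-- The `+ 1` keeps the constant nonzero, so that the right side is `∞` when `f` has no expansion.
-/
theorem normSq_const_mul_le {n : ℕ} (α : ℝ) (f : Cn n → ℂ) (c : ℂ) :
    normSq α (fun z => c * f z) ≤ ENNReal.ofReal (‖c‖ ^ 2 + 1) * normSq α f := by
  by_cases hf : ∃ a, HasExpansion f a
  swap
  · rw [normSq_eq_top α hf, ENNReal.mul_top (by simp; positivity)]
    exact le_top
  obtain ⟨a, ha⟩ := hf
  rw [normSq_eq α ha, normSq_eq α (ha.const_mul c), ← ENNReal.tsum_mul_left]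
  refine ENNReal.tsum_le_tsum fun k => ?_
  have hw := weight_nonneg n α k
  rw [← ENNReal.ofReal_mul (by positivity)]
  refine ENNReal.ofReal_le_ofReal ?_
  rw [norm_mul, mul_pow]
  nlinarith [mul_nonneg hw (sq_nonneg ‖a k‖)]

/-- With `J = |j|` and `K = |k|`, the product of factorials gains at most `(n+K+J)^J`, the
denominator gains at least `(n+K)^J`, and `n+K+J ≤ (1+J)(n+K)`. This makes monomials bounded
multipliers. -/
theorem exists_weight_add_le {n : ℕ} (hn : 1 ≤ n) (α : ℝ) (j : Fin n → ℕ) :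
    ∃ C : ℝ, 0 < C ∧ ∀ k, weight n α (j + k) ≤ C * weight n α k := by
  set J := ∑ i, j i with hJ
  refine ⟨(1 + (J : ℝ)) ^ |α| * (1 + (J : ℝ)) ^ J, by positivity, fun k => ?_⟩
  set K := ∑ i, k i with hK
  have hn' : (1 : ℝ) ≤ n := by exact_mod_cast hn
  have hn0 : (0 : ℝ) < n := by linarith
  have hsum : ∑ i, (j + k) i = K + J := by
    simp [sum_add_distrib, hJ, hK, add_comm]
  have hJ0 : (0 : ℝ) ≤ J := Nat.cast_nonneg J
  have hK0 : (0 : ℝ) ≤ K := Nat.cast_nonneg K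
  have h1 : ((n : ℝ) + ((K + J : ℕ) : ℝ)) ^ α ≤ (1 + (J : ℝ)) ^ |α| * ((n : ℝ) + K) ^ α := by
    have hpos : (0 : ℝ) < n + K := by positivity
    have hle : (n : ℝ) + ((K + J : ℕ) : ℝ) ≤ (1 + J) * (n + K) := by
      push_cast
      nlinarith [mul_nonneg hJ0 hK0, mul_nonneg hJ0 (sub_nonneg.2 hn')]
    rcases le_total 0 α with h | h
    · rw [abs_of_nonneg h, ← Real.mul_rpow (by positivity) (by positivity)]
      exact Real.rpow_le_rpow (by positivity) hle h
    · refine (Real.rpow_le_rpow_of_nonpos hpos ?_ h).trans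
        (le_mul_of_one_le_left (by positivity) ?_)
      · push_cast
        linarith
      · exact Real.one_le_rpow (by linarith) (abs_nonneg α)
  have h2 : ∏ i, (((j + k) i).factorial : ℝ) ≤
      ((n : ℝ) + (K + J : ℕ)) ^ J * ∏ i, ((k i).factorial : ℝ) := by
    rw [show ((n : ℝ) + (K + J : ℕ)) ^ J = ∏ i, ((n : ℝ) + (K + J : ℕ)) ^ j i from
      (prod_pow_eq_pow_sum _ _ _).symm, ← prod_mul_distrib]
    refine prod_le_prod (fun i _ => by positivity) fun i _ => ?_
    rw [Pi.add_apply, add_comm, ← Nat.factorial_mul_ascFactorial, Nat.cast_mul, mul_comm]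
    gcongr
    have h3 : (((k i + 1).ascFactorial (j i) : ℕ) : ℝ) ≤ ((k i : ℝ) + j i) ^ j i := by
      exact_mod_cast Nat.ascFactorial_le_pow_add (k i) (j i)
    refine h3.trans (pow_le_pow_left₀ (by positivity) ?_ _)
    have h4 : (k i : ℝ) ≤ K := by exact_mod_cast single_le_sum (fun _ _ => Nat.zero_le _) (mem_univ i)
    have h5 : (j i : ℝ) ≤ J := by exact_mod_cast single_le_sum (fun _ _ => Nat.zero_le _) (mem_univ i)
    push_cast
    linarith
  have h3 : ((n : ℝ) + K) ^ J * ((n - 1 + K).factorial : ℝ) ≤ ((n - 1 + (K + J)).factorial : ℝ) := by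
    have h4 := Nat.factorial_mul_pow_le_factorial (m := n - 1 + K) (n := J)
    have h5 : n - 1 + K + 1 = n + K := by omega
    rw [h5, add_assoc] at h4
    rw [mul_comm]
    exact_mod_cast h4
  have h6 : ((n : ℝ) + (K + J : ℕ)) ^ J ≤ (1 + (J : ℝ)) ^ J * ((n : ℝ) + K) ^ J := by
    rw [← mul_pow]
    refine pow_le_pow_left₀ (by positivity) ?_ _
    push_cast
    nlinarith [mul_nonneg hJ0 hK0, mul_nonneg hJ0 (sub_nonneg.2 hn')]
  have hPk : (0 : ℝ) < ∏ i, ((k i).factorial : ℝ) := prod_pos fun i _ => by positivity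
  have hPjk : (0 : ℝ) < ∏ i, (((j + k) i).factorial : ℝ) := prod_pos fun i _ => by positivity
  rw [weight, weight, hsum, ← hK]
  rw [div_le_iff₀ (by positivity)]
  calc ((n : ℝ) + ((K + J : ℕ) : ℝ)) ^ α * (((n - 1).factorial : ℝ) *
        ∏ i, (((j + k) i).factorial : ℝ))
      ≤ ((1 + (J : ℝ)) ^ |α| * ((n : ℝ) + K) ^ α) * (((n - 1).factorial : ℝ) *
        ((1 + (J : ℝ)) ^ J * ((n : ℝ) + K) ^ J * ∏ i, ((k i).factorial : ℝ))) := by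
        gcongr
        exact h2.trans (by gcongr)
    _ = (1 + (J : ℝ)) ^ |α| * (1 + (J : ℝ)) ^ J * (((n : ℝ) + K) ^ α *
        (((n - 1).factorial : ℝ) * ∏ i, ((k i).factorial : ℝ)) / ((n - 1 + K).factorial : ℝ)) *
        (((n : ℝ) + K) ^ J * ((n - 1 + K).factorial : ℝ)) := by
        field_simp
    _ ≤ _ := by
        gcongr

theorem exists_normSq_monom_mul_le {n : ℕ} (hn : 1 ≤ n) (α : ℝ) (j : Fin n → ℕ) :
    ∃ C : ℝ≥0∞, C ≠ ∞ ∧ ∀ f : Cn n → ℂ, normSq α (fun z => monom j z * f z) ≤ C * normSq α f := by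
  obtain ⟨C, hC, hw⟩ := exists_weight_add_le hn α j
  refine ⟨ENNReal.ofReal C, ENNReal.ofReal_ne_top, fun f => ?_⟩
  by_cases hf : ∃ a, HasExpansion f a
  swap
  · rw [normSq_eq_top α hf, ENNReal.mul_top (by simpa using hC)]
    exact le_top
  obtain ⟨a, ha⟩ := hf
  rw [normSq_eq α ha, normSq_eq α (ha.monom_mul j), tsum_extend (add_right_injective j),
    ← ENNReal.tsum_mul_left]
  refine ENNReal.tsum_le_tsum fun k => ?_
  rw [← ENNReal.ofReal_mul hC.le, ← mul_assoc]
  exact ENNReal.ofReal_le_ofReal (mul_le_mul_of_nonneg_right (hw k) (sq_nonneg _))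

theorem normSq_zero {n : ℕ} (α : ℝ) : normSq α (fun _ : Cn n => (0 : ℂ)) = 0 := by
  have h : HasExpansion (fun _ : Cn n => (0 : ℂ)) (fun _ => 0) := fun z _ => by
    simp [hasSum_zero]
  rw [normSq_eq α h]
  simp

theorem exists_normSq_sum_monom_mul_le {n : ℕ} (hn : 1 ≤ n) (α : ℝ) (a : (Fin n → ℕ) → ℂ)
    (s : Finset (Fin n → ℕ)) :
    ∃ C : ℝ≥0∞, C ≠ ∞ ∧ ∀ f : Cn n → ℂ,
      normSq α (fun z => ∑ k ∈ s, a k * (monom k z * f z)) ≤ C * normSq α f := by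
  induction s using Finset.induction_on with
  | empty => exact ⟨0, by simp, fun f => by simp [normSq_zero]⟩
  | insert k s hk ih =>
    obtain ⟨C, hC, h⟩ := ih
    obtain ⟨D, hD, h'⟩ := exists_normSq_monom_mul_le hn α k
    refine ⟨2 * (ENNReal.ofReal (‖a k‖ ^ 2 + 1) * D + C), by finiteness, fun f => ?_⟩
    have h1 := normSq_add_le α (fun z => a k * (monom k z * f z))
      (fun z => ∑ k ∈ s, a k * (monom k z * f z))
    have h2 : (fun z => ∑ k ∈ insert k s, a k * (monom k z * f z)) =
        (fun z => a k * (monom k z * f z)) + fun z => ∑ k ∈ s, a k * (monom k z * f z) := by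
      funext z
      simp [sum_insert hk]
    rw [h2]
    refine h1.trans ?_
    rw [mul_assoc, add_mul, mul_assoc]
    gcongr
    · exact (normSq_const_mul_le α _ _).trans (mul_le_mul' le_rfl (h' f))
    · exact h f

theorem dirichletNorm_lt_top_iff {n : ℕ} {α : ℝ} {f : Cn n → ℂ} :
    dirichletNorm α f < ∞ ↔ normSq α f < ∞ := by
  rw [dirichletNorm, ENNReal.rpow_lt_top_iff_of_pos (by norm_num)]

theorem dirichletNorm_sq {n : ℕ} (α : ℝ) (f : Cn n → ℂ) : dirichletNorm α f ^ 2 = normSq α f := by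
  rw [dirichletNorm, ← ENNReal.rpow_natCast, ← ENNReal.rpow_mul]
  norm_num

/-- Polynomials are dense in the Dirichlet-type space. -/
theorem exists_normSq_sub_sum_lt {n : ℕ} {α : ℝ} {g : Cn n → ℂ} (hg : normSq α g ≠ ∞)
    {ε : ℝ≥0∞} (hε : 0 < ε) :
    ∃ (a : (Fin n → ℕ) → ℂ) (s : Finset (Fin n → ℕ)),
      normSq α (fun z => g z - ∑ k ∈ s, a k * monom k z) < ε := by
  obtain ⟨a, ha⟩ := exists_hasExpansion hg
  have hfin := hg
  rw [normSq_eq α ha] at hfin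
  obtain ⟨s, hs⟩ := ((ENNReal.tendsto_tsum_compl_atTop_zero hfin).eventually
    (gt_mem_nhds hε)).exists
  refine ⟨a, s, ?_⟩
  have hexp : HasExpansion (fun z => g z - ∑ k ∈ s, a k * monom k z)
      (fun k => if k ∈ s then 0 else a k) := by
    intro z hz
    have h1 := (ha z hz).sub (hasSum_sum_of_ne_finset_zero (s := s)
      (f := fun k => if k ∈ s then a k * monom k z else 0) fun k hk => if_neg hk)
    rw [sum_congr rfl fun k hk => if_pos hk] at h1
    refine (congrArg (HasSum · _) (funext fun k => ?_)).mpr h1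
    by_cases hk : k ∈ s <;> simp [hk]
  rw [normSq_eq α hexp]
  refine lt_of_eq_of_lt ?_ hs
  refine Eq.trans ?_ (tsum_subtype {k | k ∉ s}
    fun k => ENNReal.ofReal (weight n α k * ‖a k‖ ^ 2)).symm
  refine tsum_congr fun k => ?_
  by_cases hk : k ∈ s <;> simp [hk]

/-- A function in the space whose polynomial multiples approximate `1` is cyclic. -/
theorem isCyclic_of_approx_one {n : ℕ} (hn : 1 ≤ n) {α : ℝ} {f : Cn n → ℂ}
    (hf : f ∈ dirichletSpace n α)
    (h : ∀ ε : ℝ≥0∞, 0 < ε → ∃ p : MvPolynomial (Fin n) ℂ,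
      normSq α (fun z : Cn n => 1 - MvPolynomial.eval (fun i => z i) p * f z) < ε) :
    IsCyclic α f := by
  refine ⟨hf, Set.Subset.antisymm (fun g hg => hg.1) fun g hg => ⟨hg, fun ε hε => ?_⟩⟩
  have hε2 : 0 < ε ^ 2 / 4 := ENNReal.div_pos (pow_ne_zero 2 hε.ne') (by simp)
  -- A polynomial `Q` near `g` is fixed first; `p` is then chosen according to the multiplier
  -- constant of `Q`. The final estimate uses `g - Q p f = (g - Q) + Q (1 - p f)`.
  obtain ⟨a, s, hs⟩ := exists_normSq_sub_sum_lt (dirichletNorm_lt_top_iff.1 hg.2).ne hε2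
  obtain ⟨C, hC, hCs⟩ := exists_normSq_sum_monom_mul_le hn α a s
  obtain ⟨p, hp⟩ := h (ε ^ 2 / 4 / (C + 1)) (ENNReal.div_pos hε2.ne' (by finiteness))
  set F : Cn n → ℂ := fun z => 1 - MvPolynomial.eval (fun i => z i) p * f z with hF
  have hsmall : C * normSq α F < ε ^ 2 / 4 := by
    rw [ENNReal.lt_div_iff_mul_lt (by simp) (by left; finiteness)] at hp
    refine lt_of_le_of_lt ?_ hp
    rw [mul_comm]
    gcongr
    exact le_self_add
  refine ⟨fun z => ∑ k ∈ s, a k * (monom k z * (MvPolynomial.eval (fun i => z i) p * f z)),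
    ?_, ?_⟩
  · have he : (fun z : Cn n => ∑ k ∈ s, a k * (monom k z *
        (MvPolynomial.eval (fun i => z i) p * f z))) =
        ∑ k ∈ s, ∑ j ∈ p.support, (a k * p.coeff j) •
          fun z : Cn n => monom (k + ⇑j) z * f z := by
      funext z
      simp only [Finset.sum_apply, Pi.smul_apply, smul_eq_mul, MvPolynomial.eval_eq', sum_mul,
        mul_sum, monom_add]
      refine sum_congr rfl fun k _ => sum_congr rfl fun j _ => ?_
      simp only [monom]
      ring
    rw [he]
    exact Submodule.sum_mem _ fun k _ => Submodule.sum_mem _ fun j _ =>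
      Submodule.smul_mem _ _ (Submodule.subset_span ⟨k + ⇑j, rfl⟩)
  · have hsplit : (g - fun z : Cn n => ∑ k ∈ s, a k * (monom k z *
        (MvPolynomial.eval (fun i => z i) p * f z))) =
        (fun z => g z - ∑ k ∈ s, a k * monom k z) + fun z => ∑ k ∈ s, a k * (monom k z * F z) := by
      funext z
      simp only [Pi.sub_apply, Pi.add_apply, hF, mul_sub, mul_one, sum_sub_distrib]
      ring
    have hlt : normSq α (g - fun z : Cn n => ∑ k ∈ s, a k * (monom k z *
        (MvPolynomial.eval (fun i => z i) p * f z))) < ε ^ 2 := by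
      rw [hsplit]
      refine (normSq_add_le α _ _).trans_lt ?_
      have h1 := ENNReal.add_lt_add hs ((hCs F).trans_lt hsmall)
      have h2 := (ENNReal.mul_lt_mul_iff_right (a := 2) (by simp) (by simp)).2 h1
      refine h2.trans_le (le_of_eq ?_)
      rw [← two_mul, ← mul_assoc]
      norm_num
      exact ENNReal.mul_div_cancel (by simp) (by simp)
    rw [← dirichletNorm_sq] at hlt
    exact lt_of_not_ge fun hle => hlt.not_ge (pow_le_pow_left₀ zero_le hle 2)

end DirichletBall

/-! ### Transfer between the ball and one variable. -/

namespace DirichletBall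

open Finset

theorem diagExp_add {n : ℕ} (M : Fin n → ℕ) (m i r : ℕ) :
    diagExp M m (i + r) = diagExp M m i + diagExp M m r := by
  funext x
  simp only [diagExp, Pi.add_apply]
  split_ifs <;> ring

theorem exists_mem_firstIdx {n m : ℕ} (hm : 1 ≤ m) (hmn : m ≤ n) : ∃ x, x ∈ firstIdx n m :=
  ⟨⟨0, by omega⟩, by simp only [firstIdx, mem_filter, mem_univ, true_and]; omega⟩

theorem le_of_diagExp_le {n m : ℕ} (hm : 1 ≤ m) (hmn : m ≤ n) {M : Fin n → ℕ}
    (hM : ∀ i ∈ firstIdx n m, 1 ≤ M i) {r l : ℕ} (h : diagExp M m r ≤ diagExp M m l) : r ≤ l := by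
  obtain ⟨x, hx⟩ := exists_mem_firstIdx hm hmn
  have h1 := h x
  rw [diagExp, diagExp, if_pos hx, if_pos hx] at h1
  exact le_of_mul_le_mul_right h1 (hM x hx)

theorem diagExp_injective {n m : ℕ} (hm : 1 ≤ m) (hmn : m ≤ n) {M : Fin n → ℕ}
    (hM : ∀ i ∈ firstIdx n m, 1 ≤ M i) : Function.Injective (diagExp M m) := fun _ _ h =>
  le_antisymm (le_of_diagExp_le hm hmn hM h.le) (le_of_diagExp_le hm hmn hM h.ge)

/-- The dilation factor `μ^{1/2}`. -/
noncomputable def dil {n : ℕ} (M : Fin n → ℕ) (m : ℕ) : ℂ := ((mu M m ^ (1 / 2 : ℝ) : ℝ) : ℂ)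

theorem norm_dil_sq {n m : ℕ} {M : Fin n → ℕ} (hM : ∀ i ∈ firstIdx n m, 1 ≤ M i) :
    ‖dil M m‖ ^ 2 = mu M m := by
  have h := mu_pos M hM
  rw [dil, Complex.norm_real, Real.norm_of_nonneg (by positivity), ← Real.rpow_natCast,
    ← Real.rpow_mul h.le]
  norm_num

theorem dil_ne_zero {n m : ℕ} {M : Fin n → ℕ} (hM : ∀ i ∈ firstIdx n m, 1 ≤ M i) :
    dil M m ≠ 0 := by
  intro h
  have h1 := norm_dil_sq hM
  have h2 := mu_pos M hM
  rw [h, norm_zero] at h1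
  norm_num at h1
  linarith

theorem norm_dil_mul_prod_lt_one {n m : ℕ} (hm : 1 ≤ m) (hmn : m ≤ n) {M : Fin n → ℕ}
    (hM : ∀ i ∈ firstIdx n m, 1 ≤ M i) {z : Cn n} (hz : z ∈ unitBall n) :
    ‖dil M m * ∏ i ∈ firstIdx n m, z i ^ M i‖ < 1 := by
  have h := mu_mul_prod_sq_lt_one hm hmn M hM hz
  rw [← norm_dil_sq hM, ← mul_pow] at h
  have h1 : ‖dil M m * ∏ i ∈ firstIdx n m, z i ^ M i‖ =
      ‖dil M m‖ * ∏ i ∈ firstIdx n m, ‖z i‖ ^ M i := by simp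
  rw [h1]
  exact (sq_lt_one_iff₀ (mul_nonneg (norm_nonneg _)
    (prod_nonneg fun i _ => by positivity))).1 h

/-- The coefficients of `h(μ^{1/2} z_1^{M_1} ⋯ z_m^{M_m})`, where `h` has the coefficients `b`. -/
noncomputable def diagCoeff {n : ℕ} (M : Fin n → ℕ) (m : ℕ) (b : PowerSeries ℂ) :
    (Fin n → ℕ) → ℂ :=
  Function.extend (diagExp M m) (fun l => PowerSeries.coeff l b * dil M m ^ l) 0

theorem diagCoeff_diagExp {n m : ℕ} (hm : 1 ≤ m) (hmn : m ≤ n) {M : Fin n → ℕ}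
    (hM : ∀ i ∈ firstIdx n m, 1 ≤ M i) (b : PowerSeries ℂ) (l : ℕ) :
    diagCoeff M m b (diagExp M m l) = PowerSeries.coeff l b * dil M m ^ l :=
  (diagExp_injective hm hmn hM).extend_apply _ _ _

theorem RepresentsOn.hasExpansion {n m : ℕ} (hm : 1 ≤ m) (hmn : m ≤ n) {M : Fin n → ℕ}
    (hM : ∀ i ∈ firstIdx n m, 1 ≤ M i) {b : PowerSeries ℂ} {h : ℂ → ℂ}
    (hb : RepresentsOn 1 b h) {f : Cn n → ℂ}
    (hf : ∀ z ∈ unitBall n, f z = h (dil M m * ∏ i ∈ firstIdx n m, z i ^ M i)) :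
    HasExpansion f (diagCoeff M m b) := by
  refine hasExpansion_extend (diagExp_injective hm hmn hM) fun z hz => ?_
  rw [hf z hz]
  refine (congrArg (HasSum · _) (funext fun l => ?_)).mpr
    (hb _ (norm_dil_mul_prod_lt_one hm hmn hM hz))
  rw [monom_diagExp, mul_pow, mul_assoc]

theorem weight_mul_norm_sq {n m : ℕ} {M : Fin n → ℕ}
    (hM : ∀ i ∈ firstIdx n m, 1 ≤ M i) (α : ℝ) (x : ℂ) (l : ℕ) :
    weight n α (diagExp M m l) * ‖x * dil M m ^ l‖ ^ 2 =
      weight n α (diagExp M m l) * mu M m ^ l * ‖x‖ ^ 2 := by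
  rw [norm_mul, norm_pow, mul_pow, pow_right_comm, norm_dil_sq hM]
  ring

theorem ofReal_mul_wNormSq (c β : ℝ) (hc : 0 ≤ c) (y : PowerSeries ℂ) :
    ENNReal.ofReal c * wNormSq β y =
      ∑' l : ℕ, ENNReal.ofReal (c * ((l : ℝ) + 1) ^ β * ‖PowerSeries.coeff l y‖ ^ 2) := by
  rw [wNormSq, ← ENNReal.tsum_mul_left]
  refine tsum_congr fun l => ?_
  rw [ENNReal.ofReal_mul (by positivity), ENNReal.ofReal_mul hc, mul_assoc,
    ENNReal.ofReal_pow (norm_nonneg _), ofReal_norm]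

/-- Comparison of the norm in the ball with the one-variable norm of the diagonal part. -/
theorem exists_normSq_diag_bounds {n m : ℕ} (hm : 1 ≤ m) (hmn : m ≤ n) {M : Fin n → ℕ}
    (hM : ∀ i ∈ firstIdx n m, 1 ≤ M i) (α : ℝ) :
    ∃ c C : ℝ, 0 < c ∧ 0 < C ∧
      (∀ (F : Cn n → ℂ) (e : (Fin n → ℕ) → ℂ) (y : PowerSeries ℂ), HasExpansion F e →
        (∀ l, e (diagExp M m l) = PowerSeries.coeff l y * dil M m ^ l) →
        ENNReal.ofReal c * wNormSq (betaOf n m α) y ≤ normSq α F) ∧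
      ∀ (F : Cn n → ℂ) (y : PowerSeries ℂ), HasExpansion F (diagCoeff M m y) →
        normSq α F ≤ ENNReal.ofReal C * wNormSq (betaOf n m α) y := by
  obtain ⟨c, C, hc, hC, hb⟩ := exists_weight_diagExp_bounds hm hmn M hM α
  refine ⟨c, C, hc, hC, fun F e y hF he => ?_, fun F y hF => ?_⟩
  · rw [normSq_eq α hF, ofReal_mul_wNormSq _ _ hc.le]
    -- Only the diagonal terms of the norm are kept, so `F` need not be diagonal here.
    refine le_trans (ENNReal.tsum_le_tsum fun l => ?_)
      (ENNReal.tsum_comp_le_tsum_of_injective (diagExp_injective hm hmn hM)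
        fun k => ENNReal.ofReal (weight n α k * ‖e k‖ ^ 2))
    rw [he, weight_mul_norm_sq hM]
    exact ENNReal.ofReal_le_ofReal (mul_le_mul_of_nonneg_right (hb l).1 (sq_nonneg _))
  · rw [normSq_eq α hF, ofReal_mul_wNormSq _ _ hC.le, diagCoeff,
      tsum_extend (diagExp_injective hm hmn hM)]
    refine ENNReal.tsum_le_tsum fun l => ?_
    rw [weight_mul_norm_sq hM]
    exact ENNReal.ofReal_le_ofReal (mul_le_mul_of_nonneg_right (hb l).2 (sq_nonneg _))

/-- If `j` plus a diagonal exponent is diagonal, then `j` is diagonal and the splitting is unique,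
so at most one term is nonzero. The antidiagonal form matches the coefficients of a product of power
series. -/
theorem extend_diagCoeff_diagExp {n m : ℕ} (hm : 1 ≤ m) (hmn : m ≤ n) {M : Fin n → ℕ}
    (hM : ∀ i ∈ firstIdx n m, 1 ≤ M i) (b : PowerSeries ℂ) (j : Fin n → ℕ) (l : ℕ) :
    Function.extend (fun k => j + k) (diagCoeff M m b) 0 (diagExp M m l) =
      ∑ ir ∈ antidiagonal l, if j = diagExp M m ir.1 then
        PowerSeries.coeff ir.2 b * dil M m ^ ir.2 else 0 := by
  by_cases h : ∃ ir ∈ antidiagonal l, j = diagExp M m ir.1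
  · obtain ⟨⟨i, r⟩, hir, rfl⟩ := h
    have hl := mem_antidiagonal.1 hir
    simp only at hl
    rw [sum_eq_single (i, r), if_pos rfl, ← diagCoeff_diagExp hm hmn hM, ← hl, diagExp_add]
    · exact (add_right_injective (diagExp M m i)).extend_apply _ _ _
    · rintro ⟨i', r'⟩ hir' hne
      refine if_neg fun heq => hne ?_
      have h1 := diagExp_injective hm hmn hM heq
      have h2 := mem_antidiagonal.1 hir'
      simp only at h1 h2
      rw [Prod.mk.injEq]
      omega
    · exact fun h' => absurd hir h'
  · push Not at h
    rw [sum_eq_zero fun ir hir => if_neg (h ir hir)]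
    by_cases hk : ∃ k, j + k = diagExp M m l
    swap
    · exact Function.extend_apply' _ _ _ hk
    obtain ⟨k, hk⟩ := hk
    rw [← hk, show j + k = (fun k => j + k) k from rfl, (add_right_injective j).extend_apply]
    refine Function.extend_apply' _ _ _ ?_
    rintro ⟨r, rfl⟩
    have hrl : r ≤ l := le_of_diagExp_le hm hmn hM (by rw [← hk]; exact le_add_self)
    refine h (l - r, r) (mem_antidiagonal.2 (Nat.sub_add_cancel hrl)) ?_
    have h1 := diagExp_add M m (l - r) r
    rw [Nat.sub_add_cancel hrl, ← hk] at h1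
    exact add_right_cancel h1

/-- The exponents of `diagExp` as a finitely supported function. -/
noncomputable def diagFinsupp {n : ℕ} (M : Fin n → ℕ) (m l : ℕ) : Fin n →₀ ℕ :=
  Finsupp.equivFunOnFinite.symm (diagExp M m l)

theorem coe_diagFinsupp {n : ℕ} (M : Fin n → ℕ) (m l : ℕ) :
    ⇑(diagFinsupp M m l) = diagExp M m l := rfl

theorem coe_eq_diagExp_iff {n : ℕ} (M : Fin n → ℕ) (m l : ℕ) (j : Fin n →₀ ℕ) :
    ⇑j = diagExp M m l ↔ j = diagFinsupp M m l := by
  rw [← coe_diagFinsupp, DFunLike.coe_fn_eq]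

/-- The one-variable polynomial formed from the diagonal coefficients of a polynomial. -/
noncomputable def diagPart {n : ℕ} (M : Fin n → ℕ) (m N : ℕ) (p : MvPolynomial (Fin n) ℂ) :
    Polynomial ℂ :=
  ∑ i ∈ range (N + 1), Polynomial.monomial i (p.coeff (diagFinsupp M m i) / dil M m ^ i)

theorem natDegree_diagPart_le {n : ℕ} (M : Fin n → ℕ) (m N : ℕ) (p : MvPolynomial (Fin n) ℂ) :
    (diagPart M m N p).natDegree ≤ N :=
  Polynomial.natDegree_sum_le_of_forall_le _ _ fun _ hi =>
    (Polynomial.natDegree_monomial_le _).trans (Nat.lt_succ_iff.1 (mem_range.1 hi))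

/-- The cut-off at `N` loses nothing: for `i > N` the diagonal exponent has an entry `i * M x > N`,
excluded by the degree restriction. -/
theorem coeff_diagPart {n m : ℕ} (hm : 1 ≤ m) (hmn : m ≤ n) {M : Fin n → ℕ}
    (hM : ∀ i ∈ firstIdx n m, 1 ≤ M i) {N : ℕ} {p : MvPolynomial (Fin n) ℂ}
    (hp : p ∈ MvPolynomial.restrictDegree (Fin n) ℂ N) (i : ℕ) :
    (diagPart M m N p).coeff i = p.coeff (diagFinsupp M m i) / dil M m ^ i := by
  simp only [diagPart, Polynomial.finsetSum_coeff, Polynomial.coeff_monomial, sum_ite_eq',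
    mem_range]
  split_ifs with h
  · rfl
  · obtain ⟨x, hx⟩ := exists_mem_firstIdx hm hmn
    have hnot : diagFinsupp M m i ∉ p.support := by
      intro hmem
      have h1 := (MvPolynomial.mem_restrictDegree _ p N).1 hp _ hmem x
      rw [coe_diagFinsupp, diagExp, if_pos hx] at h1
      have h2 := Nat.le_mul_of_pos_right i (hM x hx)
      omega
    rw [MvPolynomial.notMem_support_iff.1 hnot, zero_div]

/-- This reduces the lower bound to one variable: on the diagonal, `1 - p f` has the coefficients of
the one-variable expression formed with `diagPart`. -/
theorem exists_hasExpansion_one_sub_mul {n m : ℕ} (hm : 1 ≤ m) (hmn : m ≤ n) {M : Fin n → ℕ}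
    (hM : ∀ i ∈ firstIdx n m, 1 ≤ M i) {b : PowerSeries ℂ} {f : Cn n → ℂ}
    (hf : HasExpansion f (diagCoeff M m b)) {N : ℕ} {p : MvPolynomial (Fin n) ℂ}
    (hp : p ∈ MvPolynomial.restrictDegree (Fin n) ℂ N) :
    ∃ e, HasExpansion (fun z : Cn n => 1 - MvPolynomial.eval (fun i => z i) p * f z) e ∧
      ∀ l, e (diagExp M m l) =
        PowerSeries.coeff l (1 - (diagPart M m N p : PowerSeries ℂ) * b) * dil M m ^ l := by
  have h1 : HasExpansion (fun _ : Cn n => (1 : ℂ)) (diagCoeff M m 1) := by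
    have := representsOn_polynomial 1 1
    simp only [Polynomial.coe_one, Polynomial.eval_one] at this
    exact this.hasExpansion hm hmn hM fun _ _ => rfl
  have h2 := (HasExpansion.sum p.support fun j _ =>
    (hf.monom_mul ⇑j).const_mul (p.coeff j)).const_mul (-1)
  have hfun : (fun z : Cn n => 1 - MvPolynomial.eval (fun i => z i) p * f z) =
      (fun _ => 1) + fun z => -1 * ∑ j ∈ p.support, p.coeff j * (monom (⇑j) z * f z) := by
    funext z
    simp only [Pi.add_apply, MvPolynomial.eval_eq', sum_mul, neg_mul, one_mul, sub_eq_add_neg]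
    congr 2
    exact sum_congr rfl fun j _ => by rw [monom]; ring
  rw [hfun]
  refine ⟨_, h1.add h2, fun l => ?_⟩
  simp only [Pi.add_apply, diagCoeff_diagExp hm hmn hM, extend_diagCoeff_diagExp hm hmn hM,
    map_sub, sub_mul, neg_mul, one_mul, ← sub_eq_add_neg]
  congr 1
  simp only [mul_sum]
  rw [sum_comm, PowerSeries.coeff_mul, sum_mul]
  refine sum_congr rfl fun ir hir => ?_
  simp only [coe_eq_diagExp_iff, mul_ite, mul_zero, sum_ite_eq']
  have h4 : (if diagFinsupp M m ir.1 ∈ p.support then p.coeff (diagFinsupp M m ir.1) *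
      (PowerSeries.coeff ir.2 b * dil M m ^ ir.2) else 0) = p.coeff (diagFinsupp M m ir.1) *
      (PowerSeries.coeff ir.2 b * dil M m ^ ir.2) := by
    split_ifs with h
    · rfl
    · rw [MvPolynomial.notMem_support_iff.1 h, zero_mul]
  have h5 := pow_ne_zero ir.1 (dil_ne_zero hM)
  rw [h4, Polynomial.coeff_coe, coeff_diagPart hm hmn hM hp, ← mem_antidiagonal.1 hir, pow_add]
  field_simp

/-- The polynomial `q(μ^{1/2} z_1^{M_1} ⋯ z_m^{M_m})`. -/
noncomputable def diagLift {n : ℕ} (M : Fin n → ℕ) (m : ℕ) (q : Polynomial ℂ) :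
    MvPolynomial (Fin n) ℂ :=
  ∑ i ∈ range (q.natDegree + 1),
    MvPolynomial.monomial (diagFinsupp M m i) (q.coeff i * dil M m ^ i)

theorem eval_diagLift {n : ℕ} (M : Fin n → ℕ) (m : ℕ) (q : Polynomial ℂ) (z : Cn n) :
    MvPolynomial.eval (fun i => z i) (diagLift M m q) =
      q.eval (dil M m * ∏ i ∈ firstIdx n m, z i ^ M i) := by
  rw [diagLift, map_sum, Polynomial.eval_eq_sum_range]
  refine sum_congr rfl fun i _ => ?_
  rw [MvPolynomial.eval_monomial, mul_pow, ← monom_diagExp, monom,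
    Finsupp.prod_fintype _ _ fun _ => pow_zero _, coe_diagFinsupp, mul_assoc]

theorem diagLift_mem_restrictDegree {n m : ℕ} {M : Fin n → ℕ} {q : Polynomial ℂ} {N : ℕ}
    (hq : q.natDegree * ∑ i ∈ firstIdx n m, M i ≤ N) :
    diagLift M m q ∈ MvPolynomial.restrictDegree (Fin n) ℂ N := by
  refine Submodule.sum_mem _ fun i hi => ?_
  rw [MvPolynomial.mem_restrictDegree]
  intro s hs x
  rw [mem_singleton.1 (MvPolynomial.support_monomial_subset hs), coe_diagFinsupp, diagExp]
  split_ifs with hx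
  · refine le_trans (Nat.mul_le_mul (Nat.lt_succ_iff.1 (mem_range.1 hi)) ?_) hq
    exact single_le_sum (fun _ _ => Nat.zero_le _) hx
  · exact Nat.zero_le _

theorem distOne_sq_le {n : ℕ} (α : ℝ) (f : Cn n → ℂ) {N : ℕ} {p : MvPolynomial (Fin n) ℂ}
    (hp : p ∈ MvPolynomial.restrictDegree (Fin n) ℂ N) :
    distOne α f N ^ 2 ≤
      normSq α (fun z : Cn n => 1 - MvPolynomial.eval (fun i => z i) p * f z) := by
  rw [← dirichletNorm_sq]
  exact pow_le_pow_left₀ zero_le (iInf₂_le p hp) 2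

theorem le_distOne_sq {n : ℕ} (α : ℝ) (f : Cn n → ℂ) {N : ℕ} {t : ℝ≥0∞}
    (h : ∀ p ∈ MvPolynomial.restrictDegree (Fin n) ℂ N,
      t ≤ normSq α (fun z : Cn n => 1 - MvPolynomial.eval (fun i => z i) p * f z)) :
    t ≤ distOne α f N ^ 2 := by
  have ht : t = (t ^ (1 / 2 : ℝ)) ^ 2 := by
    rw [← ENNReal.rpow_natCast, ← ENNReal.rpow_mul]
    norm_num
  rw [ht]
  refine pow_le_pow_left₀ zero_le (le_iInf₂ fun p hp => ?_) 2
  exact ENNReal.rpow_le_rpow (h p hp) (by norm_num)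

theorem ofReal_inv_kernelSum (β : ℝ) (N : ℕ) :
    (ENNReal.ofReal (kernelSum β (N + 1)))⁻¹ = ENNReal.ofReal (kernelSum β (N + 1))⁻¹ :=
  (ENNReal.ofReal_inv_of_pos (kernelSum_pos β (Nat.succ_pos N))).symm

/-- The two-sided estimate in terms of `kernelSum`, with explicit competitors. -/
theorem exists_distance_bounds {n m : ℕ} (hm : 1 ≤ m) (hmn : m ≤ n) {M : Fin n → ℕ}
    (hM : ∀ i ∈ firstIdx n m, 1 ≤ M i) {α : ℝ} (hα : betaOf n m α ≤ 1) {f : Cn n → ℂ}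
    {h : ℂ → ℂ} (hh : AnalyticOnNhd ℂ h (Metric.closedBall 0 1))
    (hne : ∀ w ∈ Metric.ball (0 : ℂ) 1, h w ≠ 0)
    (hz : ∃ w ∈ Metric.sphere (0 : ℂ) 1, h w = 0)
    (hf : ∀ z ∈ unitBall n, f z = h (dil M m * ∏ i ∈ firstIdx n m, z i ^ M i)) :
    ∃ c C : ℝ, 0 < c ∧ 0 < C ∧ ∀ N : ℕ,
      (∀ p ∈ MvPolynomial.restrictDegree (Fin n) ℂ N,
        ENNReal.ofReal (c * (kernelSum (betaOf n m α) (N + 1))⁻¹) ≤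
          normSq α (fun z : Cn n => 1 - MvPolynomial.eval (fun i => z i) p * f z)) ∧
      ∃ p ∈ MvPolynomial.restrictDegree (Fin n) ℂ N,
        normSq α (fun z : Cn n => 1 - MvPolynomial.eval (fun i => z i) p * f z) ≤
          ENNReal.ofReal (C * (kernelSum (betaOf n m α) (N + 1))⁻¹) := by
  set β := betaOf n m α
  obtain ⟨s, u, v, hs, hs0, hvu, hu, hv, hrep⟩ := exists_series_factorization hh hne hz
  set P : Polynomial ℂ := (s.map fun ζ => Polynomial.X - Polynomial.C ζ).prod with hP
  obtain ⟨ζ, hζ⟩ := Multiset.exists_mem_of_ne_zero hs0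
  have hPζ : P.eval ζ = 0 := by
    rw [hP, Polynomial.eval_multiset_prod, Multiset.prod_eq_zero_iff]
    simp only [Multiset.map_map, Multiset.mem_map, Function.comp]
    exact ⟨ζ, hζ, by simp⟩
  obtain ⟨c₁, hc₁0, hc₁t, hlow⟩ := exists_le_wNormSq_one_sub_mul β (hs ζ hζ) hPζ hvu
    (ne_top_of_le_ne_top (hu 0) (coeffSum_le_moment 0 u))
    (ne_top_of_le_ne_top (hv 0) (coeffSum_le_moment 0 v))
  obtain ⟨C₁, hC₁, hup⟩ := exists_wNormSq_one_sub_mul_le (hα.trans one_le_two) s hs hvu (hu 1) hv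
  obtain ⟨c₂, C₂, hc₂, hC₂, hb1, hb2⟩ := exists_normSq_diag_bounds hm hmn hM α
  set S := ∑ i ∈ firstIdx n m, M i with hS
  have hSpos : 0 < S := by
    obtain ⟨x, hx⟩ := exists_mem_firstIdx hm hmn
    exact (hM x hx).trans (single_le_sum (f := M) (fun _ _ => Nat.zero_le _) hx)
  have hJ : 0 < (s.card + 1) * S := by positivity
  obtain ⟨C₃, hC₃, hmul⟩ := kernelSum_mul_le β hJ
  have hfexp := hrep.hasExpansion hm hmn hM hf
  -- The `+ 1` ensures positivity even if `C₁ = 0`; `C₃` pays for passing from `L` to `N`.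
  refine ⟨c₂ * c₁.toReal, C₂ * ((C₁.toReal + 1) * C₃),
    mul_pos hc₂ (ENNReal.toReal_pos hc₁0 hc₁t), by positivity,
    fun N => ⟨fun p hp => ?_, ?_⟩⟩
  · obtain ⟨e, he, hed⟩ := exists_hasExpansion_one_sub_mul hm hmn hM hfexp hp
    refine le_trans ?_ (hb1 _ e _ he hed)
    rw [mul_assoc, ENNReal.ofReal_mul hc₂.le, ENNReal.ofReal_mul ENNReal.toReal_nonneg,
      ENNReal.ofReal_toReal hc₁t, ← ofReal_inv_kernelSum]
    gcongr
    exact hlow N _ (natDegree_diagPart_le M m N p)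
  -- The competitor of index `L` has degree at most `(s.card + 1) L`, and composing with the
  -- monomial multiplies degrees by at most `S`; this is the largest `L` for which the resulting
  -- bound is at most `N`.
  · obtain ⟨q, hqd, hq⟩ := hup (N / ((s.card + 1) * S))
    refine ⟨diagLift M m q, diagLift_mem_restrictDegree ?_, ?_⟩
    · calc q.natDegree * S ≤ (s.card + 1) * (N / ((s.card + 1) * S)) * S := by gcongr
        _ = (s.card + 1) * S * (N / ((s.card + 1) * S)) := by ring
        _ ≤ N := Nat.mul_div_le _ _
    · have hrep2 : RepresentsOn 1 (1 - (q : PowerSeries ℂ) * ((P : PowerSeries ℂ) * u))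
          (fun w => 1 - q.eval w * h w) := by
        intro w hw
        have h1 := representsOn_polynomial 1 1 w hw
        have h2 := ((representsOn_polynomial 1 q).mul hrep) w hw
        simpa [sub_mul] using h1.sub h2
      have hexp := hrep2.hasExpansion hm hmn hM
        (f := fun z : Cn n => 1 - MvPolynomial.eval (fun i => z i) (diagLift M m q) * f z)
        fun z hz => by rw [eval_diagLift, hf z hz]
      refine (hb2 _ _ hexp).trans ?_
      rw [mul_assoc C₂, ENNReal.ofReal_mul hC₂.le]
      gcongr
      refine hq.trans ?_
      set L := N / ((s.card + 1) * S) with hL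
      have hk1 := kernelSum_pos β (Nat.succ_pos L)
      have hk2 := kernelSum_pos β (Nat.succ_pos N)
      have hNL : kernelSum β (N + 1) ≤ C₃ * kernelSum β (L + 1) :=
        (kernelSum_mono β (Nat.lt_mul_div_succ N hJ)).trans (hmul (L + 1))
      rw [ofReal_inv_kernelSum, mul_assoc, ENNReal.ofReal_mul (by positivity)]
      gcongr
      · exact (ENNReal.le_ofReal_iff_toReal_le hC₁ (by positivity)).2 (by linarith)
      · rw [inv_le_iff_one_le_mul₀ hk1, mul_assoc, mul_comm, mul_assoc,
          inv_mul_eq_div, le_div_iff₀ hk2, one_mul, mul_comm]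
        exact hNL

end DirichletBall

/-! ### Conclusion: from `kernelSum` to `phi`, and rescaling to the unit disk. -/

namespace DirichletBall

theorem distOne_bounds_of_kernelSum_bounds {n : ℕ} {α β : ℝ} (hβ : β ≤ 1) {f : Cn n → ℂ}
    {c C : ℝ} (hc : 0 < c) (hC : 0 < C)
    (h : ∀ N : ℕ, ENNReal.ofReal (c * (kernelSum β (N + 1))⁻¹) ≤ distOne α f N ^ 2 ∧
      distOne α f N ^ 2 ≤ ENNReal.ofReal (C * (kernelSum β (N + 1))⁻¹)) :
    ∃ c C : ℝ, 0 < c ∧ 0 < C ∧ ∀ N : ℕ, (β = 1 → 1 ≤ N) →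
      ENNReal.ofReal (c * (phi β (N + 1))⁻¹) ≤ distOne α f N ^ 2 ∧
        distOne α f N ^ 2 ≤ ENNReal.ofReal (C * (phi β (N + 1))⁻¹) := by
  obtain ⟨a, A, ha, hA, hk⟩ := exists_kernelSum_phi_bounds hβ
  refine ⟨c * A⁻¹, C * a⁻¹, by positivity, by positivity, fun N hN => ?_⟩
  obtain ⟨hp, h1, h2⟩ := hk N hN
  have hpos := kernelSum_pos β (Nat.succ_pos N)
  refine ⟨le_trans (ENNReal.ofReal_le_ofReal ?_) (h N).1,
    (h N).2.trans (ENNReal.ofReal_le_ofReal ?_)⟩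
  · rw [mul_assoc, ← mul_inv]
    gcongr
  · rw [mul_assoc, ← mul_inv]
    gcongr

theorem radius_pos {n m : ℕ} {M : Fin n → ℕ} (hM : ∀ i ∈ firstIdx n m, 1 ≤ M i) :
    0 < radius M m := Real.rpow_pos_of_pos (mu_pos M hM) _

theorem radius_mul_dil {n m : ℕ} {M : Fin n → ℕ} (hM : ∀ i ∈ firstIdx n m, 1 ≤ M i) :
    (radius M m : ℂ) * dil M m = ((mu M m ^ (1 / 4 : ℝ) : ℝ) : ℂ) := by
  rw [radius, dil, ← Complex.ofReal_mul, ← Real.rpow_add (mu_pos M hM)]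
  norm_num

theorem exists_approx_one_of_bounds {n : ℕ} {α β : ℝ} (hβ : β ≤ 1) {f : Cn n → ℂ} {C : ℝ}
    (h : ∀ N : ℕ, ∃ p : MvPolynomial (Fin n) ℂ,
      normSq α (fun z : Cn n => 1 - MvPolynomial.eval (fun i => z i) p * f z) ≤
        ENNReal.ofReal (C * (kernelSum β (N + 1))⁻¹)) (ε : ℝ≥0∞) (hε : 0 < ε) :
    ∃ p : MvPolynomial (Fin n) ℂ,
      normSq α (fun z : Cn n => 1 - MvPolynomial.eval (fun i => z i) p * f z) < ε := by
  have hlim : Filter.Tendsto (fun N : ℕ => ENNReal.ofReal (C * (kernelSum β (N + 1))⁻¹))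
      Filter.atTop (nhds 0) := by
    have h1 := ((tendsto_kernelSum hβ).comp (Filter.tendsto_add_atTop_nat 1)).inv_tendsto_atTop
    have h2 := ENNReal.tendsto_ofReal (h1.const_mul C)
    rw [mul_zero, ENNReal.ofReal_zero] at h2
    exact h2
  obtain ⟨N, hN⟩ := (hlim.eventually (gt_mem_nhds hε)).exists
  obtain ⟨p, hp⟩ := h N
  exact ⟨p, hp.trans_lt hN⟩

end DirichletBall

theorem mainTheorem4 (n m : ℕ) (hm : 1 ≤ m) (hmn : m ≤ n) (M : Fin n → ℕ)
    (hM : ∀ i : Fin n, (i : ℕ) < m → 1 ≤ M i) (α : ℝ)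
    (hα : DirichletBall.betaOf n m α ≤ 1)
    (f : DirichletBall.Cn n → ℂ) (g : ℂ → ℂ) (hfg : DirichletBall.IsDiagonal α M m f g)
    (hzero : ∀ w ∈ Metric.ball (0 : ℂ) (DirichletBall.radius M m), g w ≠ 0)
    (U : Set ℂ) (hU : IsOpen U)
    (hUball : Metric.closedBall (0 : ℂ) (DirichletBall.radius M m) ⊆ U)
    (G : ℂ → ℂ) (hG : DifferentiableOn ℂ G U)
    (hGg : ∀ w ∈ Metric.ball (0 : ℂ) (DirichletBall.radius M m), G w = g w)
    (hbdry : ∃ w ∈ Metric.sphere (0 : ℂ) (DirichletBall.radius M m), G w = 0) :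
    DirichletBall.IsCyclic α f ∧
      ∃ c C : ℝ, 0 < c ∧ 0 < C ∧
        ∀ N : ℕ, (DirichletBall.betaOf n m α = 1 → 1 ≤ N) →
          ENNReal.ofReal (c * (DirichletBall.phi (DirichletBall.betaOf n m α) (N + 1))⁻¹) ≤
              DirichletBall.distOne α f N ^ 2 ∧
            DirichletBall.distOne α f N ^ 2 ≤
              ENNReal.ofReal
                (C * (DirichletBall.phi (DirichletBall.betaOf n m α) (N + 1))⁻¹) := by
  have hM' : ∀ i ∈ DirichletBall.firstIdx n m, 1 ≤ M i := fun i hi => hM i (by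
    simpa [DirichletBall.firstIdx] using hi)
  set r := DirichletBall.radius M m with hr
  have hr0 : 0 < r := DirichletBall.radius_pos hM'
  obtain ⟨hfD, -, hfeq⟩ := hfg
  have hnorm : ∀ w : ℂ, ‖(r : ℂ) * w‖ = r * ‖w‖ := fun w => by
    rw [norm_mul, Complex.norm_real, Real.norm_of_nonneg hr0.le]
  have hballr : ∀ w : ℂ, ‖w‖ < 1 → (r : ℂ) * w ∈ Metric.ball (0 : ℂ) r := fun w hw => by
    rw [mem_ball_zero_iff, hnorm]
    exact mul_lt_of_lt_one_right hr0 hw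
  -- Rescaling by `r` moves the zeros to the unit circle; as `r * dil M m = μ^{1/4}`, the argument
  -- of `g` becomes `r` times a point of the unit disk.
  have hh : AnalyticOnNhd ℂ (fun w => G (r * w)) (Metric.closedBall 0 1) := by
    intro w hw
    have hmem : (r : ℂ) * w ∈ U := hUball (by
      rw [mem_closedBall_zero_iff, hnorm]
      exact mul_le_of_le_one_right hr0.le (by simpa using hw))
    exact (hG.analyticAt (hU.mem_nhds hmem)).fun_comp (by fun_prop)
  have hne : ∀ w ∈ Metric.ball (0 : ℂ) 1, G (r * w) ≠ 0 := by
    intro w hw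
    have hmem := hballr w (by simpa using hw)
    rw [hGg _ hmem]
    exact hzero _ hmem
  have hz : ∃ w ∈ Metric.sphere (0 : ℂ) 1, G (r * w) = 0 := by
    obtain ⟨w, hw, hw0⟩ := hbdry
    have hrc : (r : ℂ) ≠ 0 := by exact_mod_cast hr0.ne'
    have hw' : (r : ℂ) * (w / r) = w := mul_div_cancel₀ w hrc
    refine ⟨w / r, ?_, ?_⟩
    · rw [mem_sphere_zero_iff_norm] at hw ⊢
      have h1 := hnorm (w / r)
      rw [hw', hw] at h1
      exact mul_left_cancel₀ hr0.ne' (by rw [← h1, mul_one])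
    · rw [hw', hw0]
  have hf : ∀ z ∈ DirichletBall.unitBall n, f z =
      G (r * (DirichletBall.dil M m * ∏ i ∈ DirichletBall.firstIdx n m, z i ^ M i)) := by
    intro z hz
    have h1 := hballr _ (DirichletBall.norm_dil_mul_prod_lt_one hm hmn hM' hz)
    rw [hfeq z hz, hGg _ h1, ← mul_assoc, DirichletBall.radius_mul_dil hM']
  obtain ⟨c, C, hc, hC, hbounds⟩ := DirichletBall.exists_distance_bounds hm hmn hM' hα
    (h := fun w => G (r * w)) hh hne hz hf
  refine ⟨DirichletBall.isCyclic_of_approx_one (hm.trans hmn) hfD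
    (DirichletBall.exists_approx_one_of_bounds (C := C) hα fun N => ?_),
    DirichletBall.distOne_bounds_of_kernelSum_bounds hα hc hC fun N => ⟨?_, ?_⟩⟩
  · obtain ⟨p, _, hp⟩ := (hbounds N).2
    exact ⟨p, hp⟩
  · exact DirichletBall.le_distOne_sq α f (hbounds N).1
  · obtain ⟨p, hpN, hp⟩ := (hbounds N).2
    exact (DirichletBall.distOne_sq_le α f hpN).trans hp
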